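/- Conventions. For a locally Lipschitz $f:\mathbb{R}^d\to\mathbb{R}$, $\partial f(x)$ is the Clarke subdifferential (the convex hull of all limits $\lim_i\nabla f(x_i)$ with $x_i\to x$ points of differentiability of $f$), and $\partial_\sigma f(x)=\mathrm{conv}\bigcup_{\|y-x\|\le\sigma}\partial f(y)$ is the Goldstein subdifferential. For $\mathcal M\subseteq\mathbb{R}^d$, $P_{\mathcal M}(x)$ is the nearest point of $\mathcal M$ to $x$. For a map $F$, $\mathrm{lip}_F(\bar x)=\limsup_{x,x'\to\bar x,\,x\ne x'}\|F(x)-F(x')\|/\|x-x'\|$ (operator norm if $F$ is matrix valued). $\mathcal M$ is a $C^p$ manifold around $\bar x$ if $\mathcal M\cap U=F^{-1}(0)$ for some open $U\ni\bar x$ and some $C^p$ map $F:U\to\mathbb{R}^m$ with surjective Jacobian; then $T_{\mathcal M}(y)=\ker\nabla F(y)$. Put $f_{\mathcal M}=f\circ P_{\mathcal M}$ and, for $y\in\mathcal M$ near $\bar x$, $\nabla_{\mathcal M}f(y)=\nabla f_{\mathcal M}(y)$ (the covariant gradient). Assumption A. $f:\mathbb{R}^d\to\mathbb{R}$ is locally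 Lipschitz, $\bar x$ is a local minimizer of $f$, and there are $\gamma>0$, $C_{(a)}>0$ and a set $\mathcal M\ni\bar x$ such that: (A1) $f(x)-f(\bar x)\ge\frac{\gamma}{2}\|x-\bar x\|^2$ for all $x$ near $\bar x$; (A2) $\mathcal M$ is an active $C^4$ manifold of $f$ around $\bar x$: $0\in\partial f(\bar x)$, $\mathcal M$ is a $C^4$ manifold around $\bar x$, $f|_{\mathcal M}$ agrees near $\bar x$ with a $C^4$ function defined on a neighborhood of $\bar x$, and for some neighborhood $U$ of $\bar x$, $\inf\{\|v\|: v\in\partial f(x),\ x\in U\setminus\mathcal M\}>0$; (A3) $\|P_{T_{\mathcal M}(y)}(v-\nabla_{\mathcal M}f(y))\|\le C_{(a)}\|x-y\|$ for all $x\in\mathbb{R}^d$ and $y\in\mathcal M$ near $\bar x$ and all $v\in\partial f(x)$; (A4) there is a function $o:\mathbb{R}\to\mathbb{R}$ with $\lim_{t\to0}o(t)/t=0$ such that $f(y)\ge f(x)+\langle v,y-x\rangle+o(\|y-x\|)$ for all $x\in\mathbb{R}^d$ and $y\in\mathcal M$ near $\bar x$ and all $v\in\partial f(x)$. Constants. Let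 $L=2\,\mathrm{lip}_f(\bar x)$, $\beta=2\,\mathrm{lip}_{\nabla f_{\mathcal M}}(\bar x)$, $C_{\mathcal M}=2\,\mathrm{lip}_{\nabla P_{\mathcal M}}(\bar x)$, $\mu=\frac14\liminf_{x\to\bar x,\,x\notin\mathcal M}\mathrm{dist}(0,\partial f(x))\in(0,\infty]$ ($\mu=\infty$ if $\mathcal M$ is a neighborhood of $\bar x$), $D_1=\frac{\mu}{8(\mu+L)}$ ($=\frac18$ if $\mu=\infty$), and for $\delta_{\mathrm A}>0$ let $$C_2=\min\Big\{\frac{\gamma}{8C_{(a)}},\frac{\min\{1,1/\delta_{\mathrm A}\}}{2}\Big\},\qquad \delta_{\mathrm{GI}}=\min\Big\{\frac{\delta_{\mathrm A}}{4},\frac{D_1}{C_{\mathcal M}}\Big\}$$ (with $D_1/0=\infty$). Theorem (Gradient inequality). Let Assumption A hold. Then there is $\delta_0>0$ such that for every $\delta_{\mathrm A}\in(0,\delta_0]$ the constants $D_1$, $C_2$, $\delta_{\mathrm{GI}}$ are positive and the following holds for all $a_1\in(0,D_1]$ and $a_2\in(0,C_2]$. Put $$\eta=\min\Big\{\frac{\gamma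 a_2}{8\max\{4La_2^2,\beta\}},\ \frac{\mu a_1}{4\max\{2L,\beta/a_2^2\}}\Big\},$$ with values in $[0,\infty]$ (a term is $\infty$ if its numerator is $\infty$ or its denominator is $0$); then $\eta>0$. For all $x$ with $\|x-\bar x\|<\delta_{\mathrm{GI}}$ and all $\sigma>0$, $$\sigma\,\mathrm{dist}(0,\partial_\sigma f(x))\ \ge\ \eta\,(f(x)-f(\bar x))$$ whenever $(x,\sigma)$ satisfies (1) or (2): (1) (normal region) $\frac{a_1}{2}\mathrm{dist}(x,\mathcal M)\le\sigma\le a_1\mathrm{dist}(x,\mathcal M)$ and $a_2^2\|P_{\mathcal M}(x)-\bar x\|^2\le\mathrm{dist}(x,\mathcal M)$; (2) (tangent region) $\frac{a_2}{2}\|P_{\mathcal M}(x)-\bar x\|\le\sigma\le a_2\|P_{\mathcal M}(x)-\bar x\|$ and $\frac{\mathrm{dist}(x,\mathcal M)}{\sigma}\le 2a_2\|P_{\mathcal M}(x)-\bar x\|$. Moreover, for every $x\ne\bar x$ with $\|x-\bar x\|<\delta_{\mathrm{GI}}$ there is $\sigma>0$ such that (1) or (2) holds. -/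

import Mathlib

open Filter Topology
open scoped ENNReal

noncomputable section

/-- The Euclidean space `ℝ^d` (inner product norm). -/
abbrev Vec (d : ℕ) : Type := EuclideanSpace ℝ (Fin d)

/-- Clarke subdifferential: the convex hull of all limits of gradients at points of
differentiability converging to `x`. -/
def clarkeSubdiff {d : ℕ} (f : Vec d → ℝ) (x : Vec d) : Set (Vec d) :=
  convexHull ℝ {v | ∃ u : ℕ → Vec d, (∀ i, DifferentiableAt ℝ f (u i)) ∧
    Tendsto u atTop (𝓝 x) ∧ Tendsto (fun i => gradient f (u i)) atTop (𝓝 v)}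

/-- Goldstein subdifferential: the convex hull of the union of the Clarke subdifferentials over the
closed ball of radius `σ` around `x`. -/
def goldsteinSubdiff {d : ℕ} (σ : ℝ) (f : Vec d → ℝ) (x : Vec d) : Set (Vec d) :=
  convexHull ℝ (⋃ y ∈ Metric.closedBall x σ, clarkeSubdiff f y)

/-- The set of nearest points of `M` to `x`. -/
def projSet {d : ℕ} (M : Set (Vec d)) (x : Vec d) : Set (Vec d) :=
  {y | y ∈ M ∧ ∀ z ∈ M, ‖y - x‖ ≤ ‖z - x‖}

/-- The projection map onto `M`: a nearest point of `M` to `x` (it is the unique one at every `x`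
close to a point around which `M` is a `C^2` manifold). -/
def proj {d : ℕ} (M : Set (Vec d)) (x : Vec d) : Vec d :=
  Classical.epsilon (fun y => y ∈ projSet M x)

/-- The Lipschitz modulus of `F` at `x₀`: the limit superior of `‖F x - F x'‖ / ‖x - x'‖` as
`x, x' → x₀`, `x ≠ x'`. -/
def lipAt {X Y : Type*} [PseudoEMetricSpace X] [PseudoEMetricSpace Y] (F : X → Y) (x₀ : X) :
    ℝ≥0∞ :=
  limsup (fun p : X × X => edist (F p.1) (F p.2) / edist p.1 p.2)
    (𝓝 (x₀, x₀) ⊓ 𝓟 {p | p.1 ≠ p.2})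

/-- A local description of `M` as a `C^p` manifold around `x₀`: a `C^p` map `F` on an open
neighbourhood `U` of `x₀` with surjective Jacobian and `M ∩ U = F⁻¹(0)`. -/
structure LocalDefiningMap {d : ℕ} (p : ℕ) (M : Set (Vec d)) (x₀ : Vec d) where
  m : ℕ
  U : Set (Vec d)
  isOpen_U : IsOpen U
  mem_U : x₀ ∈ U
  F : Vec d → Vec m
  contDiffOn_F : ContDiffOn ℝ (p : WithTop ℕ∞) F U
  surjective_fderiv : ∀ x ∈ U, Function.Surjective (fderiv ℝ F x)
  inter_eq : M ∩ U = {x | x ∈ U ∧ F x = 0}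

/-- The tangent space `T_M(y) = ker ∇F(y)`, for `y ∈ M` near `x₀`. -/
def LocalDefiningMap.tangentSpace {d p : ℕ} {M : Set (Vec d)} {x₀ : Vec d}
    (φ : LocalDefiningMap p M x₀) (y : Vec d) : Submodule ℝ (Vec d) :=
  LinearMap.ker (fderiv ℝ φ.F y).toLinearMap

/-- The smooth extension `f_M = f ∘ P_M`. -/
def smoothExt {d : ℕ} (f : Vec d → ℝ) (M : Set (Vec d)) (x : Vec d) : ℝ := f (proj M x)

/-- The covariant gradient `∇_M f(y) = ∇ f_M(y)`, for `y ∈ M`. -/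
def covGrad {d : ℕ} (f : Vec d → ℝ) (M : Set (Vec d)) (y : Vec d) : Vec d :=
  gradient (smoothExt f M) y

/-- `M` (which is a `C^p` manifold around `x₀` by `φ`) is an active `C^p` manifold of `f` around
the critical point `x₀`. -/
structure IsActiveManifold {d p : ℕ} (f : Vec d → ℝ) {M : Set (Vec d)} {x₀ : Vec d}
    (_φ : LocalDefiningMap p M x₀) : Prop where
  mem : x₀ ∈ M
  critical : (0 : Vec d) ∈ clarkeSubdiff f x₀
  smooth : ∃ (V : Set (Vec d)) (g : Vec d → ℝ), IsOpen V ∧ x₀ ∈ V ∧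
    ContDiffOn ℝ (p : WithTop ℕ∞) g V ∧ ∀ y ∈ V ∩ M, g y = f y
  sharp : ∃ U ∈ 𝓝 x₀, ∃ c > (0 : ℝ), ∀ x ∈ U \ M, ∀ v ∈ clarkeSubdiff f x, c ≤ ‖v‖

/-- The structural assumption on `f` at the local minimizer `x₀`, with active manifold `M`,
quadratic growth constant `γ` and strong (a) constant `Ca`. -/
structure MainAssumption {d : ℕ} (f : Vec d → ℝ) {M : Set (Vec d)} {x₀ : Vec d}
    (φ : LocalDefiningMap 4 M x₀) (γ Ca : ℝ) : Prop where
  locallyLipschitz : LocallyLipschitz f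
  isLocalMin : IsLocalMin f x₀
  γ_pos : 0 < γ
  quadraticGrowth : ∀ᶠ x in 𝓝 x₀, γ / 2 * ‖x - x₀‖ ^ 2 ≤ f x - f x₀
  activeManifold : IsActiveManifold f φ
  Ca_pos : 0 < Ca
  strongA : ∀ᶠ q : Vec d × Vec d in 𝓝 (x₀, x₀), q.2 ∈ M → ∀ v ∈ clarkeSubdiff f q.1,
    ‖(φ.tangentSpace q.2).starProjection (v - covGrad f M q.2)‖ ≤ Ca * ‖q.1 - q.2‖
  bRegular : ∃ o : ℝ → ℝ, Tendsto (fun t => o t / t) (𝓝[≠] 0) (𝓝 0) ∧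
    ∀ᶠ q : Vec d × Vec d in 𝓝 (x₀, x₀), q.2 ∈ M → ∀ v ∈ clarkeSubdiff f q.1,
      f q.1 + inner ℝ v (q.2 - q.1) + o ‖q.2 - q.1‖ ≤ f q.2

/-- `L = 2 lip_f(x₀)`. -/
def constL {d : ℕ} (f : Vec d → ℝ) (x₀ : Vec d) : ℝ≥0∞ := 2 * lipAt f x₀

/-- `β = 2 lip_{∇ f_M}(x₀)`. -/
def constBeta {d : ℕ} (f : Vec d → ℝ) (M : Set (Vec d)) (x₀ : Vec d) : ℝ≥0∞ :=
  2 * lipAt (gradient (smoothExt f M)) x₀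

/-- `C_M = 2 lip_{∇ P_M}(x₀)`, in the operator norm. -/
def constCM {d : ℕ} (M : Set (Vec d)) (x₀ : Vec d) : ℝ≥0∞ :=
  2 * lipAt (fderiv ℝ (proj M)) x₀

/-- `μ` is one quarter of the limit inferior of `dist(0, ∂f(x))` as `x → x₀`, `x ∉ M`. It is `∞` if
`M` is a neighbourhood of `x₀`. -/
def constMu {d : ℕ} (f : Vec d → ℝ) (M : Set (Vec d)) (x₀ : Vec d) : ℝ≥0∞ :=
  liminf (fun x => Metric.infEDist 0 (clarkeSubdiff f x)) (𝓝[Mᶜ] x₀) / 4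

/-- `D₁ = μ / (8 (μ + L))`, read as its limit `1 / 8` if `μ = ∞`. -/
def constD1 {d : ℕ} (f : Vec d → ℝ) (M : Set (Vec d)) (x₀ : Vec d) : ℝ≥0∞ :=
  open Classical in
  if constMu f M x₀ = ∞ then 1 / 8
  else constMu f M x₀ / (8 * (constMu f M x₀ + constL f x₀))

/-- `C₂ = min {γ / (8 Ca), min {1, 1 / δA} / 2}`. -/
def constC2 (γ Ca δA : ℝ) : ℝ := min (γ / (8 * Ca)) (min 1 (1 / δA) / 2)

/-- `δ_GI = min {δA / 4, D₁ / C_M}` (where `D₁ / 0 = ∞`). -/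
def deltaGI {d : ℕ} (f : Vec d → ℝ) (M : Set (Vec d)) (x₀ : Vec d) (δA : ℝ) : ℝ≥0∞ :=
  min (ENNReal.ofReal (δA / 4)) (constD1 f M x₀ / constCM M x₀)

/-- The constant
`η = min {γ a₂ / (8 max {4 L a₂², β}), μ a₁ / (4 max {2 L, β / a₂²})}`. -/
def constEta {d : ℕ} (f : Vec d → ℝ) (M : Set (Vec d)) (x₀ : Vec d) (γ a₁ a₂ : ℝ) : ℝ≥0∞ :=
  min
    (ENNReal.ofReal (γ * a₂) /
      (8 * max (4 * constL f x₀ * ENNReal.ofReal (a₂ ^ 2)) (constBeta f M x₀)))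
    (constMu f M x₀ * ENNReal.ofReal a₁ /
      (4 * max (2 * constL f x₀) (constBeta f M x₀ / ENNReal.ofReal (a₂ ^ 2))))

/-- The normal region. -/
def NormalRegion {d : ℕ} (M : Set (Vec d)) (x₀ : Vec d) (a₁ a₂ : ℝ) (x : Vec d) (σ : ℝ) : Prop :=
  a₁ / 2 * Metric.infDist x M ≤ σ ∧ σ ≤ a₁ * Metric.infDist x M ∧
    a₂ ^ 2 * ‖proj M x - x₀‖ ^ 2 ≤ Metric.infDist x M

/-- The tangent region. -/
def TangentRegion {d : ℕ} (M : Set (Vec d)) (x₀ : Vec d) (a₂ : ℝ) (x : Vec d) (σ : ℝ) : Prop :=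
  a₂ / 2 * ‖proj M x - x₀‖ ≤ σ ∧ σ ≤ a₂ * ‖proj M x - x₀‖ ∧
    Metric.infDist x M / σ ≤ 2 * a₂ * ‖proj M x - x₀‖

end

open MeasureTheory Metric

open ContinuousLinearMap (adjoint)

/-! Write `p = proj M x`, `n = ‖p - x₀‖` and `D = infDist x M`. Near `x₀` the gap `f x - f x₀` is at
most `L D + β n² / 2`, and in either region one of `D`, `n²` controls the other. It remains to bound
the norms of Goldstein subgradients below by a constant (normal region) or by a multiple of `n`
(tangent region) and to multiply by the lower bound on `σ`. A lower bound on a linear functional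
`⟪w, ·⟫` over the nearby Clarke subdifferentials survives the convex hull, so each region only needs
a good direction `w` (`le_norm_of_mem_goldsteinSubdiff`).

Normal region: `w = x - p`. By (A4), `⟪v, y - p⟫` is at least `f y - f p` up to a small error.
Sharpness (`eventually_sharp`) makes `f y` exceed the value at its projection by a multiple of the
distance to `M`, while `f` is nearly constant along `M` because its covariant gradient vanishes at
`x₀`. Replacing `y` by `x` costs at most a Lipschitz constant times `σ`, which `D₁` keeps small.

Tangent region: `w = covGrad f M p`. Quadratic growth gives `‖w‖ ≥ (γ/2) n`, and (A3) keeps the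
tangential part of every nearby `v` within `(γ/4) n` of `w`.

Two tools are needed: an approximate Fermat rule for Clarke subgradients, which gives sharpness, and
`C^3` regularity of the projection, which gives the calculus of `f_M`. -/

/-! ### Clarke subgradients: mean value inequality and Fermat rule. -/

/-- The limits of gradients of `f` at points of differentiability tending to `x`. -/
def limitingGradients {d : ℕ} (f : Vec d → ℝ) (x : Vec d) : Set (Vec d) :=
  {v | ∃ u : ℕ → Vec d, (∀ i, DifferentiableAt ℝ f (u i)) ∧
    Tendsto u atTop (𝓝 x) ∧ Tendsto (fun i => gradient f (u i)) atTop (𝓝 v)}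

lemma norm_gradient {d : ℕ} (f : Vec d → ℝ) (x : Vec d) : ‖gradient f x‖ = ‖fderiv ℝ f x‖ := by
  simp [gradient]

lemma inner_gradient {d : ℕ} (f : Vec d → ℝ) (x h : Vec d) :
    inner ℝ (gradient f x) h = fderiv ℝ f x h := by
  simp [gradient]

lemma norm_gradient_le_of_lipschitzOn {d : ℕ} {f : Vec d → ℝ} {x : Vec d} {K : NNReal}
    {s : Set (Vec d)} (hs : s ∈ 𝓝 x) (hf : LipschitzOnWith K f s) : ‖gradient f x‖ ≤ K := by
  rw [norm_gradient]
  exact norm_fderiv_le_of_lipschitzOn ℝ hs hf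

lemma norm_le_of_mem_clarkeSubdiff {d : ℕ} {f : Vec d → ℝ} {x v : Vec d} {K : NNReal}
    {s : Set (Vec d)} (hs : s ∈ 𝓝 x) (hf : LipschitzOnWith K f s)
    (hv : v ∈ clarkeSubdiff f x) : ‖v‖ ≤ K := by
  have h : clarkeSubdiff f x ⊆ closedBall 0 (K : ℝ) := by
    refine convexHull_min ?_ (convex_closedBall _ _)
    rintro w ⟨u, -, hu, hw⟩
    refine isClosed_closedBall.mem_of_tendsto hw ?_
    filter_upwards [hu.eventually (eventually_mem_nhds_iff.2 hs)] with i hi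
    simpa using norm_gradient_le_of_lipschitzOn hi hf
  simpa using h hv

lemma gradient_mem_clarkeSubdiff {d : ℕ} {f : Vec d → ℝ} {x : Vec d}
    (h : DifferentiableAt ℝ f x) : gradient f x ∈ clarkeSubdiff f x :=
  subset_convexHull _ _ ⟨fun _ => x, fun _ => h, tendsto_const_nhds, tendsto_const_nhds⟩

/-- Nearby gradients are bounded by `K`, so they subconverge. Used contrapositively: a closed
condition that no limiting gradient satisfies fails for all gradients near `x`. -/
lemma exists_mem_limitingGradients {d : ℕ} {f : Vec d → ℝ} {x : Vec d} {K : NNReal}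
    {s Q : Set (Vec d)} (hs : s ∈ 𝓝 x) (hf : LipschitzOnWith K f s) (hQ : IsClosed Q)
    (h : ∃ᶠ u in 𝓝 x, DifferentiableAt ℝ f u ∧ gradient f u ∈ Q) :
    ∃ v ∈ limitingGradients f x, v ∈ Q := by
  have h' := h.and_eventually (eventually_mem_nhds_iff.2 hs)
  obtain ⟨u, hu, hp⟩ := exists_seq_forall_of_frequently h'
  obtain ⟨v, -, ψ, hψ, hv⟩ := (isCompact_closedBall (0 : Vec d) (K : ℝ)).tendsto_subseq
    (x := fun i => gradient f (u i))
    (fun i => by simpa using norm_gradient_le_of_lipschitzOn (hp i).2 hf)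
  exact ⟨v, ⟨u ∘ ψ, fun i => (hp _).1.1, hu.comp hψ.tendsto_atTop, hv⟩,
    hQ.mem_of_tendsto hv (.of_forall fun i => (hp _).1.2)⟩

lemma frequently_differentiableAt {d : ℕ} {f : Vec d → ℝ} {x : Vec d} {K : NNReal}
    {s : Set (Vec d)} (hs : s ∈ 𝓝 x) (hf : LipschitzOnWith K f s) :
    ∃ᶠ u in 𝓝 x, DifferentiableAt ℝ f u := by
  have hae := hf.ae_differentiableWithinAt_of_mem (μ := volume)
  rw [frequently_iff]
  intro U hU
  have hUs : interior (U ∩ s) ∈ 𝓝 x := interior_mem_nhds.2 (inter_mem hU hs)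
  by_contra! hcon
  have h0 : volume (interior (U ∩ s)) = 0 := by
    refine measure_mono_null ?_ hae
    intro y hy hyd
    have := interior_subset hy
    exact hcon y this.1 ((hyd this.2).differentiableAt
      (mem_of_superset (isOpen_interior.mem_nhds hy) (interior_subset.trans Set.inter_subset_right)))
  exact (isOpen_interior.measure_pos volume ⟨x, mem_of_mem_nhds hUs⟩).ne' h0

/-- Lebourg-type mean value inequality: a bound on the derivative in direction `h` at the points of
differentiability bounds the increments in direction `h`. -/
lemma LipschitzWith.sub_le_of_fderiv_le {d : ℕ} {f : Vec d → ℝ} {K : NNReal}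
    (hf : LipschitzWith K f) {z h : Vec d} {r c t : ℝ} (ht : 0 ≤ t) (htr : t * ‖h‖ < r)
    (hc : ∀ u ∈ ball z r, DifferentiableAt ℝ f u → fderiv ℝ f u h ≤ c) :
    f (z + t • h) - f z ≤ c * t := by
  by_contra! hlt
  obtain ⟨e, he, hlt⟩ : ∃ e, c * t < e ∧ e < f (z + t • h) - f z := exists_between hlt
  have hev : ∀ᶠ u in 𝓝 z, e < f (u + t • h) - f u := by
    have hcont : Continuous fun u => f (u + t • h) - f u :=
      (hf.continuous.comp (by fun_prop)).sub hf.continuous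
    exact hcont.continuousAt.eventually (lt_mem_nhds hlt)
  obtain ⟨ρ, hρ, hball⟩ := Metric.eventually_nhds_iff_ball.1 hev
  set δ := min ρ (r - t * ‖h‖)
  have hδ : 0 < δ := lt_min hρ (by linarith)
  set B := ball z δ
  have hBfin : volume B ≠ ∞ := measure_ball_lt_top.ne
  have hBpos : 0 < (volume B).toReal :=
    ENNReal.toReal_pos (measure_ball_pos _ _ hδ).ne' hBfin
  have hint : ∀ s : ℝ, IntegrableOn (fun u => f (u + s • h)) B := fun s =>
    ((hf.continuous.comp (by fun_prop : Continuous fun u : Vec d => u + s • h)).continuousOn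
      |>.integrableOn_compact (isCompact_closedBall z δ)).mono_set ball_subset_closedBall
  have hae : ∀ s : ℝ, ∀ᵐ u, DifferentiableAt ℝ f (u + s • h) := fun s =>
    (measurePreserving_add_right volume (s • h)).quasiMeasurePreserving.ae hf.ae_differentiableAt
  -- The segment from `z` may consist of points where `f` is not differentiable. Averaging over a
  -- small ball of base points removes the problem: by Rademacher, almost every translate is
  -- differentiable at each fixed `s`, so the average is differentiable in `s` and its derivative is
  -- the averaged directional derivative.
  have hder : ∀ s : ℝ, HasDerivAt (fun s => ∫ u in B, f (u + s • h))
      (∫ u in B, fderiv ℝ f (u + s • h) h) s := by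
    intro s
    refine (hasDerivAt_integral_of_dominated_loc_of_lip (s := Set.univ)
      (F := fun s u => f (u + s • h))
      (bound := fun _ => (K : ℝ) * ‖h‖) univ_mem
      (.of_forall fun s => (hint s).aestronglyMeasurable) (hint s) ?_ ?_
      (integrableOn_const hBfin) ?_).2
    · exact ((measurable_fderiv_apply_const ℝ f h).comp
        (measurable_add_const _)).aestronglyMeasurable
    · refine .of_forall fun u => LipschitzOnWith.of_dist_le_mul fun s₁ _ s₂ _ => ?_
      refine (hf.dist_le_mul _ _).trans ?_
      rw [dist_add_left, dist_eq_norm, ← sub_smul, norm_smul, Real.coe_nnabs,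
        abs_of_nonneg (by positivity), dist_eq_norm]
      exact le_of_eq (by ring)
    · filter_upwards [ae_restrict_of_ae (hae s)] with u hu
      have h1 : HasDerivAt (fun s : ℝ => u + s • h) h s := by
        simpa using ((hasDerivAt_id s).smul_const h).const_add u
      exact hu.hasFDerivAt.comp_hasDerivAt s h1
  have hbound : ∀ s ∈ interior (Set.Icc 0 t), deriv (fun s => ∫ u in B, f (u + s • h)) s
      ≤ c * (volume B).toReal := by
    intro s hs
    rw [interior_Icc] at hs
    rw [(hder s).deriv]
    have : ∫ u in B, c = c * (volume B).toReal := by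
      simp [Measure.real, mul_comm]
    rw [← this]
    refine setIntegral_mono_ae_restrict ?_ (integrableOn_const hBfin) ?_
    · refine Measure.integrableOn_of_bounded hBfin ?_ (M := K * ‖h‖) (.of_forall fun u => ?_)
      · exact ((measurable_fderiv_apply_const ℝ f h).comp
          (measurable_add_const _)).aestronglyMeasurable
      · exact ((fderiv ℝ f _).le_opNorm h).trans
          (mul_le_mul_of_nonneg_right (norm_fderiv_le_of_lipschitz ℝ hf) (norm_nonneg _))
    · filter_upwards [ae_restrict_of_ae (hae s), ae_restrict_mem measurableSet_ball] with u hu huB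
      refine hc _ ?_ hu
      have h1 : dist u z < r - t * ‖h‖ := (mem_ball.1 huB).trans_le (min_le_right _ _)
      have h2 : s * ‖h‖ ≤ t * ‖h‖ := mul_le_mul_of_nonneg_right hs.2.le (norm_nonneg _)
      have h3 : dist (u + s • h) u = s * ‖h‖ := by
        simp [dist_eq_norm, norm_smul, abs_of_pos hs.1]
      rw [mem_ball]
      linarith [dist_triangle (u + s • h) u z]
  have hmv := (convex_Icc (0 : ℝ) t).image_sub_le_mul_sub_of_deriv_le
    (fun s _ => (hder s).continuousAt.continuousWithinAt)
    (fun s _ => (hder s).differentiableAt.differentiableWithinAt) hbound 0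
    (Set.left_mem_Icc.2 ht) t (Set.right_mem_Icc.2 ht) ht
  have hlow : e * (volume B).toReal ≤ (∫ u in B, f (u + t • h)) - ∫ u in B, f (u + (0 : ℝ) • h) := by
    rw [← integral_sub (hint t) (hint 0)]
    have : ∫ u in B, e = e * (volume B).toReal := by simp [Measure.real, mul_comm]
    rw [← this]
    refine setIntegral_mono_on (integrableOn_const hBfin) ((hint t).sub (hint 0))
      measurableSet_ball fun u hu => ?_
    simpa using (hball u (ball_subset_ball (min_le_left _ _) hu)).le
  nlinarith

/-- Fermat's rule: if `z` is a local minimizer of `f + κ ‖· - z‖`, then `∂f(z)` comes within `κ` of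
the origin. -/
lemma infEDist_clarkeSubdiff_le {d : ℕ} {f : Vec d → ℝ} {z : Vec d} {K : NNReal}
    {s : Set (Vec d)} (hs : s ∈ 𝓝 z) (hf : LipschitzOnWith K f s) {κ : ℝ}
    (hκ : 0 ≤ κ) (hmin : ∀ᶠ w in 𝓝 z, f z ≤ f w + κ * ‖w - z‖) :
    infEDist 0 (clarkeSubdiff f z) ≤ ENNReal.ofReal κ := by
  set C := closure (clarkeSubdiff f z)
  obtain ⟨g, hg, hgf⟩ := hf.extend_real
  have hgeq : f =ᶠ[𝓝 z] g := by filter_upwards [hs] with u hu using hgf hu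
  obtain ⟨w, hw, -⟩ := exists_mem_limitingGradients hs hf isClosed_univ
    ((frequently_differentiableAt hs hf).mono fun u hu => ⟨hu, trivial⟩)
  have hne : C.Nonempty := ⟨w, subset_closure (subset_convexHull _ _ hw)⟩
  have hconv : Convex ℝ C := (convex_convexHull ℝ _).closure
  obtain ⟨v, hvC, hv⟩ := exists_norm_eq_iInf_of_complete_convex hne isClosed_closure.isComplete
    hconv 0
  have hproj := (norm_eq_iInf_iff_real_inner_le_zero hconv hvC).1 hv
  rw [← infEDist_closure]
  refine (infEDist_le_edist_of_mem hvC).trans ?_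
  rw [edist_dist, dist_zero_left]
  refine ENNReal.ofReal_le_ofReal ?_
  by_contra! hlt
  obtain ⟨e, he, hev⟩ := exists_between hlt
  have hvpos : 0 < ‖v‖ := hκ.trans_lt hlt
  -- Steepest descent direction: as `v` has least norm in `C`, every limiting gradient `y` has `⟪y,
  -- h⟫ ≤ -‖v‖ < -e`. So near `z` all gradients have slope below `-e` along `h`, and `f` falls
  -- faster than `κ` allows.
  set h : Vec d := -(‖v‖⁻¹ • v)
  have hh : ‖h‖ = 1 := by simp [h, norm_smul, hvpos.ne']
  have hnf : ¬ ∃ᶠ u in 𝓝 z, DifferentiableAt ℝ f u ∧ gradient f u ∈ {y | -e ≤ inner ℝ y h} := by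
    intro hfreq
    obtain ⟨y, hy, hyQ⟩ := exists_mem_limitingGradients hs hf
      (isClosed_le continuous_const (by fun_prop)) hfreq
    have h1 := hproj y (subset_closure (subset_convexHull _ _ hy))
    have h2 : inner ℝ y h = -(‖v‖⁻¹ * inner ℝ y v) := by simp [h, inner_smul_right]
    have h3 : inner ℝ y v = inner ℝ v y := real_inner_comm _ _
    have h4 : ‖v‖ ^ 2 ≤ inner ℝ y v := by
      simp only [zero_sub, inner_neg_left, inner_sub_right, real_inner_self_eq_norm_sq] at h1
      linarith
    have h5 : ‖v‖ ≤ ‖v‖⁻¹ * inner ℝ y v := by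
      rw [inv_mul_eq_div, le_div_iff₀ hvpos]; nlinarith
    simp only [Set.mem_ofPred_eq, h2] at hyQ
    linarith
  rw [not_frequently] at hnf
  obtain ⟨r, hr, hball⟩ := Metric.eventually_nhds_iff_ball.1
    ((hnf.and hgeq.eventually_nhds).and hmin)
  have key : ∀ u ∈ ball z r, DifferentiableAt ℝ g u → fderiv ℝ g u h ≤ -e := by
    intro u hu hd
    have hfg : f =ᶠ[𝓝 u] g := (hball u hu).1.2
    have hd' : DifferentiableAt ℝ f u := hd.congr_of_eventuallyEq hfg
    have := (hball u hu).1.1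
    rw [← hfg.fderiv_eq, ← inner_gradient]
    by_contra! hcon
    exact this ⟨hd', hcon.le⟩
  have h1 := hg.sub_le_of_fderiv_le (t := r / 2) (by positivity) (by rw [hh]; linarith) key
  have hz' : z + (r / 2) • h ∈ ball z r := by
    simp [dist_eq_norm, norm_smul, hh, abs_of_pos hr]; linarith
  have h2 := (hball _ hz').2
  rw [Eventually.self_of_nhds (hball _ hz').1.2, hgeq.self_of_nhds] at h2
  simp only [add_sub_cancel_left, norm_smul, hh, Real.norm_eq_abs, mul_one,
    abs_of_pos (half_pos hr)] at h2
  nlinarith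

/-! ### Normal coordinates around the manifold. -/

/-- The adjoint of operators between Euclidean spaces, as a continuous linear map. -/
noncomputable def adjointCLM (d m : ℕ) : (Vec d →L[ℝ] Vec m) →L[ℝ] (Vec m →L[ℝ] Vec d) :=
  LinearMap.toContinuousLinearMap
    { toFun := fun A => adjoint A
      map_add' := fun A B => map_add _ A B
      map_smul' := fun c A => by simp }

@[simp] lemma adjointCLM_apply {d m : ℕ} (A : Vec d →L[ℝ] Vec m) :
    adjointCLM d m A = adjoint A := rfl

/-- Normal coordinates along the fibres of `F`: `(p, l) ↦ (p + F'(p)^* l, F p)`. -/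
noncomputable def normalMap {d m : ℕ} (F : Vec d → Vec m) (q : Vec d × Vec m) : Vec d × Vec m :=
  (q.1 + adjointCLM d m (fderiv ℝ F q.1) q.2, F q.1)

lemma contDiffAt_normalMap {d m : ℕ} {F : Vec d → Vec m} {x : Vec d} (l : Vec m)
    (hF : ContDiffAt ℝ 4 F x) : ContDiffAt ℝ 3 (normalMap F) (x, l) := by
  have h1 : ContDiffAt ℝ 3 (fun q : Vec d × Vec m => fderiv ℝ F q.1) (x, l) :=
    (hF.fderiv_right (m := 3) (by norm_num)).comp (x, l) contDiffAt_fst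
  have h2 : ContDiffAt ℝ 3 (fun q : Vec d × Vec m => F q.1) (x, l) :=
    (hF.of_le (by norm_num)).comp (x, l) contDiffAt_fst
  exact (contDiffAt_fst.add
    (((adjointCLM d m).contDiff.contDiffAt.comp (x, l) h1).clm_apply contDiffAt_snd)).prodMk h2

lemma adjoint_injective_of_surjective {d m : ℕ} {A : Vec d →L[ℝ] Vec m}
    (hA : Function.Surjective A) : Function.Injective (adjoint A) := by
  rw [injective_iff_map_eq_zero]
  intro l hl
  obtain ⟨w, rfl⟩ := hA l
  rw [← inner_self_eq_zero (𝕜 := ℝ), ← ContinuousLinearMap.adjoint_inner_left, hl, inner_zero_left]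

/-- At `l = 0` the second derivative of `F` drops out and the differential is `(h, l) ↦ (h + A* l, A
h)`. On its kernel `h` lies both in the range of `A*` and in `ker A`, which are orthogonal.
Injectivity suffices in finite dimension. -/
lemma exists_hasFDerivAt_normalMap {d m : ℕ} {F : Vec d → Vec m} {x : Vec d}
    (hF : ContDiffAt ℝ 4 F x) (hsurj : Function.Surjective (fderiv ℝ F x)) :
    ∃ T : (Vec d × Vec m) ≃L[ℝ] (Vec d × Vec m),
      HasFDerivAt (normalMap F) (T : (Vec d × Vec m) →L[ℝ] (Vec d × Vec m)) (x, 0) := by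
  set A := fderiv ℝ F x
  have hA : HasFDerivAt F A x := (hF.differentiableAt (by norm_num)).hasFDerivAt
  have hd : DifferentiableAt ℝ (fun q : Vec d × Vec m => adjointCLM d m (fderiv ℝ F q.1)) (x, 0) :=
    ((adjointCLM d m).contDiff.contDiffAt.comp (x, (0 : Vec m))
      ((hF.fderiv_right (m := 3) (by norm_num)).comp (x, (0 : Vec m))
        contDiffAt_fst)).differentiableAt (by norm_num)
  set T' : (Vec d × Vec m) →L[ℝ] (Vec d × Vec m) :=
    (ContinuousLinearMap.fst ℝ _ _ + (adjoint A).comp (ContinuousLinearMap.snd ℝ _ _)).prod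
      (A.comp (ContinuousLinearMap.fst ℝ _ _)) with hT'
  have hsnd : HasFDerivAt (fun q : Vec d × Vec m => q.2) (ContinuousLinearMap.snd ℝ (Vec d) (Vec m))
    (x, (0 : Vec m)) := hasFDerivAt_snd
  have hfst : HasFDerivAt (fun q : Vec d × Vec m => q.1) (ContinuousLinearMap.fst ℝ (Vec d) (Vec m))
    (x, (0 : Vec m)) := hasFDerivAt_fst
  have hder : HasFDerivAt (normalMap F) T' (x, 0) := by
    refine HasFDerivAt.prodMk ?_ (hA.comp (x, (0 : Vec m)) hfst)
    refine (hfst.add (hd.hasFDerivAt.clm_apply hsnd)).congr_fderiv ?_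
    simp [A]
  have hinj : Function.Injective T'.toLinearMap := by
    rw [injective_iff_map_eq_zero]
    rintro ⟨h, l⟩ hz
    have h1 : h + adjoint A l = 0 := by
      have := congrArg Prod.fst hz
      simpa [hT', A] using this
    have h2 : A h = 0 := by
      have := congrArg Prod.snd hz
      simpa [hT', A] using this
    have h3 : h = 0 := by
      rw [← inner_self_eq_zero (𝕜 := ℝ)]
      nth_rw 1 [eq_neg_of_add_eq_zero_left h1]
      rw [inner_neg_left, ContinuousLinearMap.adjoint_inner_left, h2, inner_zero_right, neg_zero]
    rw [h3, zero_add] at h1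
    have h4 : l = 0 := adjoint_injective_of_surjective hsurj (by rw [h1, map_zero])
    rw [h3, h4]; rfl
  refine ⟨(LinearEquiv.ofInjectiveEndo T'.toLinearMap hinj).toContinuousLinearEquiv, ?_⟩
  exact hder

/-! ### Existence and smoothness of the projection. -/

section Projection

variable {d : ℕ} {M : Set (Vec d)} {x₀ : Vec d}

lemma norm_sub_le_of_mem_projSet {x p : Vec d} (hM : x₀ ∈ M) (hp : p ∈ projSet M x) :
    ‖p - x₀‖ ≤ 2 * ‖x - x₀‖ := by
  have h1 := hp.2 x₀ hM
  have h2 := norm_sub_le_norm_sub_add_norm_sub p x x₀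
  rw [norm_sub_rev x₀ x] at h1
  linarith

lemma infDist_eq_of_mem_projSet {x p : Vec d} (hp : p ∈ projSet M x) :
    infDist x M = ‖x - p‖ := by
  refine le_antisymm ((infDist_le_dist_of_mem hp.1).trans_eq (dist_eq_norm _ _)) ?_
  refine (le_infDist ⟨p, hp.1⟩).2 fun z hz => ?_
  rw [dist_comm, dist_eq_norm, norm_sub_rev x]
  exact hp.2 z hz

/-- `M` is closed only locally, so a minimizer is found in a compact piece. Points of `M` outside it
are farther from `x` than `x₀` is. -/
lemma LocalDefiningMap.eventually_proj_mem {k : ℕ} (φ : LocalDefiningMap k M x₀) (hM : x₀ ∈ M) :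
    ∀ᶠ x in 𝓝 x₀, proj M x ∈ projSet M x := by
  obtain ⟨r, hr, hrU⟩ := nhds_basis_closedBall.mem_iff.1 (φ.isOpen_U.mem_nhds φ.mem_U)
  have hclosed : IsClosed (closedBall x₀ r ∩ φ.F ⁻¹' {0}) :=
    (φ.contDiffOn_F.continuousOn.mono hrU).preimage_isClosed_of_isClosed isClosed_closedBall
      isClosed_singleton
  have heq : M ∩ closedBall x₀ r = closedBall x₀ r ∩ φ.F ⁻¹' {0} := by
    ext y
    have := Set.ext_iff.1 φ.inter_eq y
    constructor
    · rintro ⟨h1, h2⟩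
      exact ⟨h2, (this.1 ⟨h1, hrU h2⟩).2⟩
    · rintro ⟨h1, h2⟩
      exact ⟨(this.2 ⟨hrU h1, h2⟩).1, h1⟩
  have hcomp : IsCompact (M ∩ closedBall x₀ r) := by
    rw [heq]
    exact (isCompact_closedBall x₀ r).of_isClosed_subset hclosed Set.inter_subset_left
  filter_upwards [ball_mem_nhds x₀ (half_pos hr)] with x hx
  refine Classical.epsilon_spec (p := fun y => y ∈ projSet M x) ?_
  obtain ⟨q, hq, hmin⟩ := hcomp.exists_isMinOn ⟨x₀, hM, mem_closedBall_self hr.le⟩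
    (f := fun y => ‖y - x‖) (by fun_prop)
  refine ⟨q, hq.1, fun z hz => ?_⟩
  by_cases hzr : z ∈ closedBall x₀ r
  · exact hmin ⟨hz, hzr⟩
  · have h1 : ‖q - x‖ ≤ ‖x₀ - x‖ := hmin ⟨hM, mem_closedBall_self hr.le⟩
    rw [mem_closedBall, dist_eq_norm] at hzr
    rw [mem_ball, dist_eq_norm, norm_sub_rev] at hx
    have h2 := norm_sub_le_norm_sub_add_norm_sub z x x₀
    rw [norm_sub_rev x] at h2
    linarith

/-- Lagrange multipliers for the squared distance to `x` on the level set of `F`. -/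
lemma LocalDefiningMap.sub_mem_range_adjoint {k : ℕ} (hk : k ≠ 0) (φ : LocalDefiningMap k M x₀)
    {x p : Vec d} (hp : p ∈ projSet M x) (hpU : p ∈ φ.U) :
    ∃ l, adjoint (fderiv ℝ φ.F p) l = x - p := by
  have hF : HasStrictFDerivAt φ.F (fderiv ℝ φ.F p) p :=
    (φ.contDiffOn_F.contDiffAt (φ.isOpen_U.mem_nhds hpU)).hasStrictFDerivAt (by exact_mod_cast hk)
  have hFp : φ.F p = 0 := ((Set.ext_iff.1 φ.inter_eq p).1 ⟨hp.1, hpU⟩).2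
  have hφ : HasStrictFDerivAt (fun y : Vec d => ‖y - x‖ ^ 2)
      ((2 • innerSL ℝ (p - x)).comp (ContinuousLinearMap.id ℝ (Vec d))) p :=
    (hasStrictFDerivAt_norm_sq (p - x)).comp p ((hasStrictFDerivAt_id p).sub_const x)
  have hext : IsLocalExtrOn (fun y : Vec d => ‖y - x‖ ^ 2) {y | φ.F y = φ.F p} p := by
    left
    filter_upwards [self_mem_nhdsWithin, mem_nhdsWithin_of_mem_nhds (φ.isOpen_U.mem_nhds hpU)]
      with y hy hyU
    have hyM : y ∈ M := ((Set.ext_iff.1 φ.inter_eq y).2 ⟨hyU, hy.trans hFp⟩).1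
    exact pow_le_pow_left₀ (norm_nonneg _) (hp.2 y hyM) 2
  obtain ⟨Λ, Λ₀, hne, hΛ⟩ := hext.exists_linear_map_of_hasStrictFDerivAt hF hφ
  -- Surjectivity of the Jacobian rules out the abnormal multiplier.
  have hΛ₀ : Λ₀ ≠ 0 := by
    rintro rfl
    refine hne (Prod.ext (LinearMap.ext fun w => ?_) rfl)
    obtain ⟨y, rfl⟩ := φ.surjective_fderiv p hpU w
    simpa using hΛ y
  have hmem : x - p ∈ (fderiv ℝ φ.F p).toLinearMap.kerᗮ := by
    rw [Submodule.mem_orthogonal]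
    intro w hw
    have hw' : fderiv ℝ φ.F p w = 0 := hw
    have := hΛ w
    rw [hw'] at this
    have h2 : inner ℝ (p - x) w = 0 := by simpa [hΛ₀, inner_sub_left] using this
    rw [real_inner_comm, ← neg_sub, inner_neg_left, h2, neg_zero]
  rw [LinearMap.orthogonal_ker] at hmem
  exact hmem

lemma LocalDefiningMap.contDiffAt_F {k : ℕ} (φ : LocalDefiningMap k M x₀) {x : Vec d}
    (hx : x ∈ φ.U) : ContDiffAt ℝ k φ.F x :=
  φ.contDiffOn_F.contDiffAt (φ.isOpen_U.mem_nhds hx)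

/-- Bounds the Lagrange multiplier by the distance to `M`, so that the pair (projection, multiplier)
lies where `normalMap` is invertible. -/
lemma LocalDefiningMap.exists_norm_le_adjoint (φ : LocalDefiningMap 4 M x₀) :
    ∃ C > (0 : ℝ), ∀ᶠ p in 𝓝 x₀, ∀ l, ‖l‖ ≤ C * ‖adjoint (fderiv ℝ φ.F p) l‖ := by
  obtain ⟨K, hK, hanti⟩ := (adjoint (fderiv ℝ φ.F x₀)).toLinearMap.exists_antilipschitzWith
    (LinearMap.ker_eq_bot.2 (adjoint_injective_of_surjective (φ.surjective_fderiv x₀ φ.mem_U)))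
  have hK' : (0 : ℝ) < K := hK
  refine ⟨2 * K, by positivity, ?_⟩
  have hcont : ContinuousAt (fun p => adjointCLM d φ.m (fderiv ℝ φ.F p)) x₀ :=
    (adjointCLM d φ.m).continuous.continuousAt.comp
      ((φ.contDiffAt_F φ.mem_U).fderiv_right (m := 3) (by norm_num)).continuousAt
  filter_upwards [hcont.eventually (ball_mem_nhds _ (by positivity : (0 : ℝ) < 1 / (2 * K)))]
    with p hp l
  rw [dist_eq_norm] at hp
  simp only [adjointCLM_apply] at hp
  have h1 : ‖l‖ ≤ K * ‖adjoint (fderiv ℝ φ.F x₀) l‖ := by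
    simpa using hanti.le_mul_dist l 0
  have h2 := (adjoint (fderiv ℝ φ.F p) - adjoint (fderiv ℝ φ.F x₀)).le_opNorm l
  have h3 : ‖adjoint (fderiv ℝ φ.F x₀) l‖ ≤ ‖adjoint (fderiv ℝ φ.F p) l‖ + 1 / (2 * K) * ‖l‖ := by
    have h4 := norm_le_insert (adjoint (fderiv ℝ φ.F p) l) (adjoint (fderiv ℝ φ.F x₀) l)
    have h5 := mul_le_mul_of_nonneg_right hp.le (norm_nonneg l)
    rw [sub_apply] at h2
    linarith
  have h6 : K * (1 / (2 * K) * ‖l‖) = ‖l‖ / 2 := by field_simp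
  nlinarith [mul_le_mul_of_nonneg_left h3 hK'.le]

/-- By the multiplier rule `normalMap φ.F (proj M x, l) = (x, 0)` with `l` small, so `proj M` is the
first component of a local inverse on the slice `(x, 0)`. One derivative is lost because `normalMap`
contains `F'`. The same inverse shows that short normal segments project to their base point. -/
lemma LocalDefiningMap.contDiffAt_proj_and_eventually_proj_normal (φ : LocalDefiningMap 4 M x₀)
    (hM : x₀ ∈ M) : ContDiffAt ℝ 3 (proj M) x₀ ∧
      ∀ᶠ p in 𝓝 x₀, p ∈ M → ∀ l, ∀ᶠ t : ℝ in 𝓝 0,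
        proj M (p + t • adjoint (fderiv ℝ φ.F p) l) = p := by
  have hF := φ.contDiffAt_F φ.mem_U
  have hFx : φ.F x₀ = 0 := ((Set.ext_iff.1 φ.inter_eq x₀).1 ⟨hM, φ.mem_U⟩).2
  obtain ⟨T, hT⟩ := exists_hasFDerivAt_normalMap hF (φ.surjective_fderiv x₀ φ.mem_U)
  have hG := contDiffAt_normalMap (0 : Vec φ.m) hF
  have hG0 : normalMap φ.F (x₀, 0) = (x₀, 0) := by simp [normalMap, hFx]
  set e := hG.toOpenPartialHomeomorph (normalMap φ.F) hT (by norm_num) with he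
  have hsymm : ContDiffAt ℝ 3 e.symm (x₀, 0) := by
    have := hG.to_localInverse hT (by norm_num)
    rwa [hG0] at this
  have hsrc : e.source ∈ 𝓝 (x₀, (0 : Vec φ.m)) :=
    e.open_source.mem_nhds (hG.mem_toOpenPartialHomeomorph_source hT (by norm_num))
  obtain ⟨r, hr, hrs⟩ := Metric.mem_nhds_iff.1 hsrc
  have hinv : ∀ q ∈ e.source, e.symm (normalMap φ.F q) = q := fun q hq => e.left_inv hq
  obtain ⟨C, hC, hCl⟩ := φ.exists_norm_le_adjoint
  obtain ⟨s, hs, hsp⟩ := Metric.eventually_nhds_iff_ball.1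
    (hCl.and (φ.isOpen_U.mem_nhds φ.mem_U))
  have hproj : ∀ᶠ x in 𝓝 x₀, proj M x = (e.symm (x, 0)).1 := by
    filter_upwards [φ.eventually_proj_mem hM, ball_mem_nhds x₀ (half_pos hs),
      ball_mem_nhds x₀ (half_pos hr), ball_mem_nhds x₀ (div_pos hr hC)] with x hx h1 h2 h3
    rw [mem_ball, dist_eq_norm] at h1 h2 h3
    have h4 := norm_sub_le_of_mem_projSet hM hx
    have hps : proj M x ∈ ball x₀ s := by rw [mem_ball, dist_eq_norm]; linarith
    obtain ⟨l, hl⟩ := φ.sub_mem_range_adjoint (by norm_num) hx (hsp _ hps).2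
    have hl2 := (hsp _ hps).1 l
    rw [hl, norm_sub_rev] at hl2
    have h5 := hx.2 x₀ hM
    rw [norm_sub_rev x₀] at h5
    rw [lt_div_iff₀ hC] at h3
    have hq : (proj M x, l) ∈ e.source := by
      refine hrs ?_
      rw [mem_ball, Prod.dist_eq, max_lt_iff, dist_eq_norm, dist_zero_right]
      constructor
      · linarith
      · nlinarith
    have hGq : normalMap φ.F (proj M x, l) = (x, 0) := by
      have h6 : φ.F (proj M x) = 0 :=
        ((Set.ext_iff.1 φ.inter_eq _).1 ⟨hx.1, (hsp _ hps).2⟩).2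
      simp [normalMap, hl, h6]
    rw [← hGq, hinv _ hq]
  refine ⟨?_, ?_⟩
  · have : ContDiffAt ℝ 3 (fun x : Vec d => (e.symm (x, (0 : Vec φ.m))).1) x₀ :=
      contDiffAt_fst.comp x₀
        (ContDiffAt.comp x₀ hsymm (contDiffAt_id.prodMk contDiffAt_const))
    exact this.congr_of_eventuallyEq hproj
  · filter_upwards [hproj.eventually_nhds, ball_mem_nhds x₀ hr, φ.isOpen_U.mem_nhds φ.mem_U]
      with p hp hpr hpU hpM l
    have hFp : φ.F p = 0 := ((Set.ext_iff.1 φ.inter_eq p).1 ⟨hpM, hpU⟩).2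
    have ht1 : Tendsto (fun t : ℝ => p + t • adjoint (fderiv ℝ φ.F p) l) (𝓝 0) (𝓝 p) := by
      have : Continuous fun t : ℝ => p + t • adjoint (fderiv ℝ φ.F p) l := by fun_prop
      simpa using this.tendsto 0
    have ht2 : Tendsto (fun t : ℝ => (p, t • l)) (𝓝 0) (𝓝 (p, 0)) := by
      have : Continuous fun t : ℝ => (p, t • l) := by fun_prop
      simpa using this.tendsto 0
    have hsrc' : e.source ∈ 𝓝 (p, (0 : Vec φ.m)) := by
      refine e.open_source.mem_nhds (hrs ?_)
      rw [mem_ball, Prod.dist_eq, dist_self, max_lt_iff]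
      exact ⟨hpr, hr⟩
    filter_upwards [ht1.eventually hp, ht2.eventually hsrc'] with t h1 h2
    have hGq : normalMap φ.F (p, t • l) = (p + t • adjoint (fderiv ℝ φ.F p) l, 0) := by
      simp [normalMap, hFp]
    rw [h1, ← hGq, hinv _ h2]

end Projection

/-! ### Lipschitz moduli and Taylor estimates. -/

section LipschitzModulus

variable {X Y : Type*} [MetricSpace X] [PseudoEMetricSpace Y] {F : X → Y} {x₀ : X}

/-- The inequality must be strict, so doubling the modulus gives a valid constant only if the
modulus is nonzero. The cases `L = 0` and `β = 0` need separate arguments. -/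
lemma exists_lipschitzOnWith_of_lipAt_lt {c : NNReal} (h : lipAt F x₀ < c) :
    ∃ s ∈ 𝓝 x₀, LipschitzOnWith c F s := by
  have h1 := eventually_lt_of_limsup_lt h
  rw [eventually_inf_principal, nhds_prod_eq, Filter.eventually_iff, mem_prod_self_iff] at h1
  obtain ⟨s, hs, hss⟩ := h1
  refine ⟨s, hs, fun x hx y hy => ?_⟩
  rcases eq_or_ne x y with rfl | hxy
  · simp
  have h2 := hss (Set.mk_mem_prod hx hy) hxy
  exact (ENNReal.div_le_iff (edist_pos.2 hxy).ne' (edist_ne_top _ _)).1 h2.le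

lemma lipAt_le_of_lipschitzOnWith {K : NNReal} {s : Set X} (hs : s ∈ 𝓝 x₀)
    (hF : LipschitzOnWith K F s) : lipAt F x₀ ≤ K := by
  refine limsup_le_of_le (h := ?_)
  refine Filter.Eventually.filter_mono inf_le_left ?_
  filter_upwards [prod_mem_nhds hs hs] with p hp
  exact ENNReal.div_le_of_le_mul (hF hp.1 hp.2)

end LipschitzModulus

lemma edist_gradient {d : ℕ} (g : Vec d → ℝ) (x y : Vec d) :
    edist (gradient g x) (gradient g y) = edist (fderiv ℝ g x) (fderiv ℝ g y) :=
  (InnerProductSpace.toDual ℝ (Vec d)).symm.isometry.edist_eq _ _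

/-- One-dimensional Taylor estimate along a segment. -/
lemma sub_le_half_of_fderiv_le {E : Type*} [NormedAddCommGroup E] [NormedSpace ℝ E] {g : E → ℝ}
    {x h : E} {c : ℝ}
    (hd : ∀ t ∈ Set.Icc (0 : ℝ) 1, DifferentiableAt ℝ g (x + t • h))
    (hc : ∀ t ∈ Set.Icc (0 : ℝ) 1, fderiv ℝ g (x + t • h) h ≤ c * t) :
    g (x + h) - g x ≤ c / 2 := by
  have hder : ∀ t ∈ Set.Icc (0 : ℝ) 1, HasDerivAt (fun t : ℝ => g (x + t • h) - c / 2 * t ^ 2)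
      (fderiv ℝ g (x + t • h) h - c * t) t := by
    intro t ht
    have h1 : HasDerivAt (fun t : ℝ => x + t • h) h t := by
      simpa using ((hasDerivAt_id t).smul_const h).const_add x
    have h2 := ((hasDerivAt_pow 2 t).const_mul (c / 2))
    refine (((hd t ht).hasFDerivAt.comp_hasDerivAt t h1).sub h2).congr_deriv ?_
    simp only [Nat.cast_ofNat, Nat.add_one_sub_one, pow_one]
    ring
  have := (convex_Icc (0 : ℝ) 1).image_sub_le_mul_sub_of_deriv_le (C := 0)
    (fun t ht => (hder t ht).continuousAt.continuousWithinAt)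
    (fun t ht => (hder t (interior_subset ht)).differentiableAt.differentiableWithinAt)
    (fun t ht => by
      rw [(hder t (interior_subset ht)).deriv]
      linarith [hc t (interior_subset ht)]) 0 (by simp) 1 (by simp) zero_le_one
  simp at this
  linarith

lemma eventually_segment {E : Type*} [NormedAddCommGroup E] [NormedSpace ℝ E] {x₀ : E}
    {P : E → Prop} (h : ∀ᶠ x in 𝓝 x₀, P x) :
    ∀ᶠ x in 𝓝 x₀, ∀ t ∈ Set.Icc (0 : ℝ) 1, P (x₀ + t • (x - x₀)) := by
  obtain ⟨r, hr, hP⟩ := Metric.eventually_nhds_iff_ball.1 h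
  filter_upwards [ball_mem_nhds x₀ hr] with x hx t ht
  refine hP _ ?_
  rw [mem_ball, dist_eq_norm] at *
  rw [add_sub_cancel_left, norm_smul, Real.norm_eq_abs, abs_of_nonneg ht.1]
  exact (mul_le_of_le_one_left (norm_nonneg _) ht.2).trans_lt hx

/-! ### The smooth extension, finiteness of the constants, and sharpness. -/

section ActiveManifold

variable {d : ℕ} {f : Vec d → ℝ} {M : Set (Vec d)} {x₀ : Vec d}

lemma proj_eq_self {p : Vec d} (hp : p ∈ M) (h : proj M p ∈ projSet M p) : proj M p = p := by
  have := h.2 p hp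
  simpa [sub_eq_zero] using this

variable {φ : LocalDefiningMap 4 M x₀} {γ Ca : ℝ}

lemma contDiffAt_smoothExt (hA : IsActiveManifold f φ) : ContDiffAt ℝ 3 (smoothExt f M) x₀ := by
  obtain ⟨V, g, hV, hxV, hg, hgf⟩ := hA.smooth
  have hP := (φ.contDiffAt_proj_and_eventually_proj_normal hA.mem).1
  have hproj := φ.eventually_proj_mem hA.mem
  have hP0 : proj M x₀ = x₀ := proj_eq_self hA.mem hproj.self_of_nhds
  have hg' : ContDiffAt ℝ 3 g (proj M x₀) := by
    rw [hP0]
    exact (hg.contDiffAt (hV.mem_nhds hxV)).of_le (by norm_num)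
  refine (hg'.comp x₀ hP).congr_of_eventuallyEq ?_
  have hVx : ∀ᶠ x in 𝓝 x₀, proj M x ∈ V :=
    hP.continuousAt.eventually (by rw [hP0]; exact hV.mem_nhds hxV)
  filter_upwards [hproj, hVx] with x h1 h2
  exact (hgf _ ⟨h2, h1.1⟩).symm

lemma fderiv_smoothExt_eq_zero (hA : IsActiveManifold f φ) (hmin : IsLocalMin f x₀) :
    fderiv ℝ (smoothExt f M) x₀ = 0 := by
  have hP := (φ.contDiffAt_proj_and_eventually_proj_normal hA.mem).1
  have hP0 : proj M x₀ = x₀ := proj_eq_self hA.mem (φ.eventually_proj_mem hA.mem).self_of_nhds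
  refine IsLocalMin.fderiv_eq_zero ?_
  have h : Tendsto (proj M) (𝓝 x₀) (𝓝 x₀) := by simpa [hP0] using hP.continuousAt.tendsto
  filter_upwards [h.eventually hmin] with x hx
  simpa [smoothExt, hP0] using hx

/-- `f_M` is constant on short normal segments, so its gradient is orthogonal to the range of the
adjoint Jacobian. -/
lemma covGrad_mem_tangentSpace (hA : IsActiveManifold f φ) :
    ∀ᶠ p in 𝓝 x₀, p ∈ M → covGrad f M p ∈ φ.tangentSpace p := by
  have hP := φ.contDiffAt_proj_and_eventually_proj_normal hA.mem
  have hd : ∀ᶠ p in 𝓝 x₀, DifferentiableAt ℝ (smoothExt f M) p :=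
    ((contDiffAt_smoothExt hA).eventually (by norm_num)).mono
      fun p hp => hp.differentiableAt (by norm_num)
  filter_upwards [hP.2, hd, φ.eventually_proj_mem hA.mem] with p hp hdp hpr hpM
  have hpp := proj_eq_self hpM hpr
  change fderiv ℝ φ.F p (covGrad f M p) = 0
  refine ext_inner_right ℝ fun l => ?_
  rw [inner_zero_left, ← ContinuousLinearMap.adjoint_inner_right, covGrad, inner_gradient]
  set w := adjoint (fderiv ℝ φ.F p) l
  have h1 : HasDerivAt (fun t : ℝ => p + t • w) w 0 := by
    simpa using ((hasDerivAt_id (0 : ℝ)).smul_const w).const_add p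
  have h0 : HasFDerivAt (smoothExt f M) (fderiv ℝ (smoothExt f M) p) (p + (0 : ℝ) • w) := by
    simpa using hdp.hasFDerivAt
  have h2 := h0.comp_hasDerivAt (0 : ℝ) h1
  have h3 : HasDerivAt (fun t : ℝ => smoothExt f M (p + t • w)) 0 0 := by
    refine (hasDerivAt_const (0 : ℝ) (f p)).congr_of_eventuallyEq ?_
    filter_upwards [hp hpM l] with t ht
    exact congrArg f ht
  exact h2.unique h3

lemma constL_ne_top (hf : LocallyLipschitz f) : constL f x₀ ≠ ∞ := by
  obtain ⟨K, s, hs, hK⟩ := hf x₀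
  exact ENNReal.mul_ne_top (by norm_num)
    ((lipAt_le_of_lipschitzOnWith hs hK).trans_lt ENNReal.coe_lt_top).ne

lemma constBeta_ne_top (hA : IsActiveManifold f φ) : constBeta f M x₀ ≠ ∞ := by
  obtain ⟨K, s, hs, hK⟩ := ((contDiffAt_smoothExt hA).fderiv_right (m := 1)
    (by norm_num)).exists_lipschitzOnWith
  refine ENNReal.mul_ne_top (by norm_num)
    ((lipAt_le_of_lipschitzOnWith hs (K := K) ?_).trans_lt ENNReal.coe_lt_top).ne
  intro x hx y hy
  rw [edist_gradient]
  exact hK hx hy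

lemma constCM_ne_top (φ : LocalDefiningMap 4 M x₀) (hM : x₀ ∈ M) : constCM M x₀ ≠ ∞ := by
  obtain ⟨K, s, hs, hK⟩ := ((φ.contDiffAt_proj_and_eventually_proj_normal hM).1.fderiv_right
    (m := 1) (by norm_num)).exists_lipschitzOnWith
  exact ENNReal.mul_ne_top (by norm_num)
    ((lipAt_le_of_lipschitzOnWith hs hK).trans_lt ENNReal.coe_lt_top).ne

lemma constMu_pos (hA : IsActiveManifold f φ) : 0 < constMu f M x₀ := by
  obtain ⟨U, hU, c, hc, h⟩ := hA.sharp
  refine ENNReal.div_pos ?_ (by norm_num)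
  refine (lt_of_lt_of_le (ENNReal.ofReal_pos.2 hc) (le_liminf_of_le (h := ?_))).ne'
  filter_upwards [self_mem_nhdsWithin, mem_nhdsWithin_of_mem_nhds hU] with x hxM hxU
  refine le_infEDist.2 fun v hv => ?_
  rw [edist_dist, dist_zero_left]
  exact ENNReal.ofReal_le_ofReal (h x ⟨hxU, hxM⟩ v hv)

/-- `constMu` is a quarter of the limit inferior, so twice it is still strictly below that limit
when it is finite. -/
lemma eventually_lt_infEDist {κ : ℝ} (hpos : 0 < constMu f M x₀)
    (hκ : ENNReal.ofReal κ ≤ 2 * constMu f M x₀) :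
    ∀ᶠ x in 𝓝[Mᶜ] x₀, ENNReal.ofReal κ < infEDist 0 (clarkeSubdiff f x) := by
  refine eventually_lt_of_lt_liminf ?_
  set l := liminf (fun x => infEDist 0 (clarkeSubdiff f x)) (𝓝[Mᶜ] x₀) with hl
  have hmu : constMu f M x₀ = l / 4 := rfl
  rcases eq_or_ne l ∞ with htop | htop
  · rw [htop]; exact ENNReal.ofReal_lt_top
  have h1 : l = 4 * constMu f M x₀ := by
    rw [hmu, ENNReal.mul_div_cancel (by norm_num) (by norm_num)]
  have hfin : constMu f M x₀ ≠ ∞ := by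
    rw [hmu]; exact ENNReal.div_ne_top htop (by norm_num)
  refine hκ.trans_lt ?_
  rw [h1]
  exact ENNReal.mul_lt_mul_left hpos.ne' hfin (by norm_num)

/-- Strict differentiability of `f_M` at `x₀` with derivative zero. -/
lemma eventually_abs_sub_le (hA : MainAssumption f φ γ Ca) {ε : ℝ} (hε : 0 < ε) :
    ∀ᶠ q : Vec d × Vec d in 𝓝 (x₀, x₀), q.1 ∈ M → q.2 ∈ M →
      |f q.1 - f q.2| ≤ ε * ‖q.1 - q.2‖ := by
  have hA' := hA.activeManifold
  have hs : HasStrictFDerivAt (smoothExt f M) (0 : Vec d →L[ℝ] ℝ) x₀ := by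
    have := (contDiffAt_smoothExt hA').hasStrictFDerivAt (by norm_num)
    rwa [fderiv_smoothExt_eq_zero hA' hA.isLocalMin] at this
  have hproj := φ.eventually_proj_mem hA'.mem
  filter_upwards [hs.isLittleO.def hε, hproj.prod_inl_nhds x₀, hproj.prod_inr_nhds x₀]
    with q h1 h2 h3 hq1 hq2
  simpa [smoothExt, proj_eq_self hq1 h2, proj_eq_self hq2 h3] using h1

/-- Sharpness: off the manifold, `f` grows linearly with the distance to the manifold. -/
lemma eventually_sharp (hA : MainAssumption f φ γ Ca) {κ ε : ℝ} (hκ : 0 < κ) (hε : 0 < ε)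
    (hεκ : 2 * ε ≤ κ)
    (hslope : ∀ᶠ x in 𝓝[Mᶜ] x₀, ENNReal.ofReal κ < infEDist 0 (clarkeSubdiff f x)) :
    ∀ᶠ y in 𝓝 x₀, f (proj M y) + (κ - 2 * ε) * infDist y M ≤ f y := by
  have hM := hA.activeManifold.mem
  have hcont : Continuous f := hA.locallyLipschitz.continuous
  rw [eventually_nhdsWithin_iff] at hslope
  have hflat := eventually_abs_sub_le hA hε
  rw [nhds_prod_eq, Filter.eventually_iff, mem_prod_self_iff] at hflat
  obtain ⟨s, hs, hss⟩ := hflat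
  obtain ⟨r, hr, hball⟩ := Metric.eventually_nhds_iff_ball.1
    ((hslope.and hA.isLocalMin).and hs)
  have hsmall : ∀ᶠ y in 𝓝 x₀, f y - f x₀ < κ * r / 4 := by
    have : ContinuousAt (fun y => f y - f x₀) x₀ := by fun_prop
    exact this.eventually (gt_mem_nhds (by simp; positivity))
  filter_upwards [hsmall, ball_mem_nhds x₀ (by positivity : 0 < r / 4),
    φ.eventually_proj_mem hM] with y hy1 hy2 hy3
  rw [mem_ball, dist_eq_norm] at hy2
  -- Exact penalty: the minimizer `z` of `f + κ ‖· - y‖` is interior because `f y` is close to `f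
  -- x₀`. Off `M`, Fermat's rule would give a subgradient of norm about `κ` or less, against
  -- `hslope`. So `z ∈ M`, and comparing `z` with `proj M y` along `M` loses only the `ε` terms.
  obtain ⟨z, hz, hzmin⟩ := (isCompact_closedBall x₀ (r / 2)).exists_isMinOn
    ⟨x₀, mem_closedBall_self (by positivity)⟩ (f := fun z => f z + κ * ‖z - y‖) (by fun_prop)
  have hyb : y ∈ closedBall x₀ (r / 2) := by rw [mem_closedBall, dist_eq_norm]; linarith
  have h1 : f z + κ * ‖z - y‖ ≤ f y := by simpa using hzmin hyb
  have hzr : z ∈ ball x₀ r := closedBall_subset_ball (by linarith) hz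
  have h2 : f x₀ ≤ f z := (hball z hzr).1.2
  have h3 : ‖z - y‖ < r / 4 := by
    by_contra! hcon
    nlinarith
  have hzi : z ∈ ball x₀ (r / 2) := by
    rw [mem_ball, dist_eq_norm]
    linarith [norm_sub_le_norm_sub_add_norm_sub z y x₀]
  have hzM : z ∈ M := by
    by_contra hcon
    obtain ⟨K, t, ht, hK⟩ := hA.locallyLipschitz z
    refine ((hball z hzr).1.1 hcon).not_ge (infEDist_clarkeSubdiff_le ht hK hκ.le ?_)
    filter_upwards [isOpen_ball.mem_nhds hzi] with w hw
    have h4 : f z + κ * ‖z - y‖ ≤ f w + κ * ‖w - y‖ := hzmin (ball_subset_closedBall hw)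
    have h5 := norm_sub_le_norm_sub_add_norm_sub w z y
    nlinarith
  have hp := norm_sub_le_of_mem_projSet hM hy3
  have hpr : proj M y ∈ ball x₀ r := by rw [mem_ball, dist_eq_norm]; linarith
  have h4 := hss (Set.mk_mem_prod (hball _ hzr).2 (hball _ hpr).2) hzM hy3.1
  have h5 : infDist y M ≤ ‖z - y‖ := by
    rw [norm_sub_rev, ← dist_eq_norm]; exact infDist_le_dist_of_mem hzM
  have h6 := infDist_eq_of_mem_projSet hy3
  have h7 := norm_sub_le_norm_sub_add_norm_sub z y (proj M y)
  dsimp only at h4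
  have h8 := (abs_le.1 h4).1
  nlinarith

end ActiveManifold

/-! ### Growth along the manifold and lower bounds on Goldstein subgradients. -/

section GradientInequality

variable {d : ℕ} {f : Vec d → ℝ} {M : Set (Vec d)} {x₀ : Vec d}
variable {φ : LocalDefiningMap 4 M x₀} {γ Ca : ℝ}

lemma eventually_differentiableAt_smoothExt (hA : IsActiveManifold f φ) :
    ∀ᶠ p in 𝓝 x₀, DifferentiableAt ℝ (smoothExt f M) p :=
  ((contDiffAt_smoothExt hA).eventually (by norm_num)).mono
    fun _ hp => hp.differentiableAt (by norm_num)

/-- The covariant gradient grows at least linearly along the manifold. -/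
lemma eventually_le_norm_covGrad (hA : MainAssumption f φ γ Ca) {ε : ℝ} (hε : 0 < ε) :
    ∀ᶠ p in 𝓝 x₀, p ∈ M → (γ - ε) * ‖p - x₀‖ ≤ ‖covGrad f M p‖ := by
  have hA' := hA.activeManifold
  have hproj := φ.eventually_proj_mem hA'.mem
  have hg0 := fderiv_smoothExt_eq_zero hA' hA.isLocalMin
  have hdiff : DifferentiableAt ℝ (fderiv ℝ (smoothExt f M)) x₀ :=
    ((contDiffAt_smoothExt hA').fderiv_right (m := 2) (by norm_num)).differentiableAt (by norm_num)
  set H := fderiv ℝ (fderiv ℝ (smoothExt f M)) x₀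
  have hH : ∀ᶠ x in 𝓝 x₀, ‖fderiv ℝ (smoothExt f M) x - H (x - x₀)‖ ≤ ε / 2 * ‖x - x₀‖ := by
    have := hdiff.hasFDerivAt.isLittleO.def (half_pos hε)
    simpa [hg0] using this
  filter_upwards [eventually_segment (hH.and (eventually_differentiableAt_smoothExt hA')), hproj,
    hA.quadraticGrowth] with p hseg hpp hgrow hpM
  set h := p - x₀
  have hpeq : x₀ + h = p := by simp [h]
  have hbound : ∀ t ∈ Set.Icc (0 : ℝ) 1,
      |fderiv ℝ (smoothExt f M) (x₀ + t • h) h - t * H h h| ≤ ε / 2 * ‖h‖ ^ 2 * t := by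
    intro t ht
    have h1 := (hseg t ht).1
    rw [add_sub_cancel_left, norm_smul, Real.norm_eq_abs, abs_of_nonneg ht.1] at h1
    have h2 := (fderiv ℝ (smoothExt f M) (x₀ + t • h) - H (t • h)).le_opNorm h
    have h3 := mul_le_mul_of_nonneg_right h1 (norm_nonneg h)
    simp only [map_smul, sub_apply, smul_apply, smul_eq_mul, Real.norm_eq_abs] at h2 h3
    nlinarith
  -- Quadratic growth and this expansion give `H h h ≥ (γ - ε/2) ‖h‖²`; the derivative at `p` along
  -- `h` loses another `ε/2`.
  have htaylor := sub_le_half_of_fderiv_le (g := smoothExt f M) (x := x₀) (h := h)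
    (c := H h h + ε / 2 * ‖h‖ ^ 2) (fun t ht => (hseg t ht).2)
    (fun t ht => by linarith [(abs_le.1 (hbound t ht)).2])
  have h0 : proj M x₀ = x₀ := proj_eq_self hA'.mem hproj.self_of_nhds
  rw [hpeq, smoothExt, smoothExt, h0, proj_eq_self hpM hpp] at htaylor
  have h1 := (abs_le.1 (hbound 1 (by simp))).1
  rw [one_smul, hpeq] at h1
  have h2 : fderiv ℝ (smoothExt f M) p h ≤ ‖covGrad f M p‖ * ‖h‖ := by
    rw [← inner_gradient]
    exact real_inner_le_norm _ _
  rcases (norm_nonneg h).eq_or_lt' with h3 | h3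
  · rw [h3]; simp
  refine le_of_mul_le_mul_right ?_ h3
  nlinarith

/-- Quadratic upper bound of `f` along the manifold. -/
lemma eventually_sub_le_constBeta (hA : MainAssumption f φ γ Ca) :
    ∀ᶠ p in 𝓝 x₀, p ∈ M → f p - f x₀ ≤ (constBeta f M x₀).toReal / 2 * ‖p - x₀‖ ^ 2 := by
  have hA' := hA.activeManifold
  have hproj := φ.eventually_proj_mem hA'.mem
  have h0 : proj M x₀ = x₀ := proj_eq_self hA'.mem hproj.self_of_nhds
  have hg0 := fderiv_smoothExt_eq_zero hA' hA.isLocalMin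
  have key : ∀ c : NNReal, lipAt (gradient (smoothExt f M)) x₀ < c →
      ∀ᶠ p in 𝓝 x₀, p ∈ M → f p - f x₀ ≤ c / 2 * ‖p - x₀‖ ^ 2 := by
    intro c hc
    obtain ⟨s, hs, hK⟩ := exists_lipschitzOnWith_of_lipAt_lt hc
    filter_upwards [eventually_segment
      ((show ∀ᶠ x in 𝓝 x₀, x ∈ s from hs).and (eventually_differentiableAt_smoothExt hA')), hproj]
      with p hseg hpp hpM
    set h := p - x₀
    have hpeq : x₀ + h = p := by simp [h]
    have htaylor := sub_le_half_of_fderiv_le (g := smoothExt f M) (x := x₀) (h := h)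
      (c := c * ‖h‖ ^ 2) (fun t ht => (hseg t ht).2) fun t ht => by
        have h1 := hK.dist_le_mul _ (hseg t ht).1 _ (mem_of_mem_nhds hs)
        have h2 : gradient (smoothExt f M) x₀ = 0 := by
          rw [← norm_eq_zero, norm_gradient, hg0, norm_zero]
        rw [h2, dist_zero_right, dist_eq_norm, add_sub_cancel_left, norm_smul, Real.norm_eq_abs,
          abs_of_nonneg ht.1] at h1
        have h3 := real_inner_le_norm (gradient (smoothExt f M) (x₀ + t • h)) h
        rw [inner_gradient] at h3
        nlinarith [mul_le_mul_of_nonneg_right h1 (norm_nonneg h)]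
    rw [hpeq, smoothExt, smoothExt, h0, proj_eq_self hpM hpp] at htaylor
    linarith
  -- If the modulus is zero, the constant `γ/2` gives a gap of at most `(γ/4) ‖p - x₀‖²`. Quadratic
  -- growth then forces `p = x₀`.
  rcases eq_or_ne (lipAt (gradient (smoothExt f M)) x₀) 0 with hl | hl
  · have hc : (0 : ℝ) ≤ γ / 2 := by linarith [hA.γ_pos]
    have := key (.mk (γ / 2) hc) (by
      rw [hl, ENNReal.coe_pos, ← NNReal.coe_pos]; exact half_pos hA.γ_pos)
    filter_upwards [this, hA.quadraticGrowth] with p hp hgrow hpM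
    have h1 := hp hpM
    have h2 := hA.γ_pos
    rw [NNReal.coe_mk] at h1
    have h3 : ‖p - x₀‖ ^ 2 ≤ 0 := by nlinarith
    have h4 : ‖p - x₀‖ ^ 2 = 0 := le_antisymm h3 (by positivity)
    rw [h4] at h1 ⊢
    simpa using h1
  · have hfin := constBeta_ne_top hA'
    refine key (constBeta f M x₀).toNNReal ?_
    rw [ENNReal.coe_toNNReal hfin, constBeta, two_mul]
    refine ENNReal.lt_add_right (fun h => hfin ?_) hl
    rw [constBeta, h]; exact ENNReal.mul_top (by norm_num)

/-- A positive real number that is admissible as a slope off the manifold. -/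
lemma exists_slope (hA : IsActiveManifold f φ) :
    ∃ κ > (0 : ℝ), ENNReal.ofReal κ ≤ 2 * constMu f M x₀ := by
  obtain ⟨κ, hκ, hlt⟩ := ENNReal.lt_iff_exists_nnreal_btwn.1 (constMu_pos hA)
  refine ⟨κ, by exact_mod_cast hκ, ?_⟩
  rw [ENNReal.ofReal_coe_nnreal, two_mul]
  exact hlt.le.trans le_self_add

/-- Sharpness would make `f` grow off `M` at rate `(κ + K)/2 > K`, which a `K`-Lipschitz function
cannot do. This covers `μ = ∞` and `L = 0`. -/
lemma eventually_infDist_eq_zero_of_slope (hA : MainAssumption f φ γ Ca) {κ : ℝ} {K : NNReal}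
    {s : Set (Vec d)} (hs : s ∈ 𝓝 x₀) (hK : LipschitzOnWith K f s) (hKκ : K < κ)
    (hκ : ENNReal.ofReal κ ≤ 2 * constMu f M x₀) :
    ∀ᶠ x in 𝓝 x₀, infDist x M = 0 := by
  have hM := hA.activeManifold.mem
  have hproj := φ.eventually_proj_mem hM
  have hκ0 : 0 < κ := K.coe_nonneg.trans_lt hKκ
  have hK0 := K.coe_nonneg
  have hsharp := eventually_sharp hA (ε := (κ - K) / 4) hκ0 (by linarith) (by linarith)
    (eventually_lt_infEDist (constMu_pos hA.activeManifold) hκ)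
  have h0 : proj M x₀ = x₀ := proj_eq_self hM hproj.self_of_nhds
  have htend : Tendsto (proj M) (𝓝 x₀) (𝓝 x₀) := by
    simpa [h0] using
      (φ.contDiffAt_proj_and_eventually_proj_normal hM).1.continuousAt.tendsto
  filter_upwards [hsharp, hproj, hs, htend.eventually hs] with x h1 h2 h3 h4
  have h5 := hK.dist_le_mul _ h3 _ h4
  rw [Real.dist_eq, dist_eq_norm, ← infDist_eq_of_mem_projSet h2] at h5
  have h6 := (le_abs_self _).trans h5
  have h7 := infDist_nonneg (x := x) (s := M)
  nlinarith

lemma eventually_sub_proj_le (hA : MainAssumption f φ γ Ca) :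
    ∀ᶠ x in 𝓝 x₀, f x - f (proj M x) ≤ (constL f x₀).toReal * infDist x M := by
  have hM := hA.activeManifold.mem
  have hproj := φ.eventually_proj_mem hM
  have h0 : proj M x₀ = x₀ := proj_eq_self hM hproj.self_of_nhds
  rcases eq_or_ne (lipAt f x₀) 0 with hl | hl
  · obtain ⟨κ, hκ, hκμ⟩ := exists_slope hA.activeManifold
    obtain ⟨s, hs, hK⟩ := exists_lipschitzOnWith_of_lipAt_lt (F := f) (x₀ := x₀)
      (c := .mk (κ / 2) (half_pos hκ).le) (by
        rw [hl, ENNReal.coe_pos, ← NNReal.coe_pos]; exact half_pos hκ)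
    filter_upwards [eventually_infDist_eq_zero_of_slope hA hs hK (half_lt_self hκ) hκμ, hproj]
      with x h1 h2
    have h3 : x = proj M x := by
      rwa [infDist_eq_of_mem_projSet h2, norm_eq_zero, sub_eq_zero] at h1
    rw [h1, ← h3]; simp
  · have hfin := constL_ne_top (x₀ := x₀) hA.locallyLipschitz
    obtain ⟨s, hs, hK⟩ := exists_lipschitzOnWith_of_lipAt_lt (F := f) (x₀ := x₀)
      (c := (constL f x₀).toNNReal) (by
        rw [ENNReal.coe_toNNReal hfin, constL, two_mul]
        refine ENNReal.lt_add_right (fun h => hfin ?_) hl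
        rw [constL, h]; exact ENNReal.mul_top (by norm_num))
    have htend : Tendsto (proj M) (𝓝 x₀) (𝓝 x₀) := by
      simpa [h0] using
        (φ.contDiffAt_proj_and_eventually_proj_normal hM).1.continuousAt.tendsto
    filter_upwards [hproj, hs, htend.eventually hs] with x h2 h3 h4
    have h5 := hK.dist_le_mul _ h3 _ h4
    rw [Real.dist_eq, dist_eq_norm, ← infDist_eq_of_mem_projSet h2] at h5
    exact (le_abs_self _).trans h5

/-- Upper bound of the function gap by the distances to and along the manifold. -/
lemma eventually_sub_le (hA : MainAssumption f φ γ Ca) :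
    ∀ᶠ x in 𝓝 x₀, f x - f x₀ ≤ (constL f x₀).toReal * infDist x M +
      (constBeta f M x₀).toReal / 2 * ‖proj M x - x₀‖ ^ 2 := by
  have hM := hA.activeManifold.mem
  have hproj := φ.eventually_proj_mem hM
  have h0 : proj M x₀ = x₀ := proj_eq_self hM hproj.self_of_nhds
  have htend : Tendsto (proj M) (𝓝 x₀) (𝓝 x₀) := by
    simpa [h0] using
      (φ.contDiffAt_proj_and_eventually_proj_normal hM).1.continuousAt.tendsto
  filter_upwards [eventually_sub_proj_le hA, hproj,
    htend.eventually (eventually_sub_le_constBeta hA)] with x h1 h2 h3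
  linarith [h3 h2.1]

lemma goldsteinSubdiff_nonempty (hf : LocallyLipschitz f) (x : Vec d) {σ : ℝ} (hσ : 0 < σ) :
    (goldsteinSubdiff σ f x).Nonempty := by
  obtain ⟨K, s, hs, hK⟩ := hf x
  obtain ⟨y, hy, hyσ⟩ := ((frequently_differentiableAt hs hK).and_eventually
    (closedBall_mem_nhds x hσ)).exists
  exact ⟨_, subset_convexHull _ _ (Set.mem_biUnion hyσ (gradient_mem_clarkeSubdiff hy))⟩

/-- A lower bound of a linear functional on the nearby Clarke subdifferentials passes to the norms of
the elements of the Goldstein subdifferential. -/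
lemma le_norm_of_mem_goldsteinSubdiff {x w g : Vec d} {σ c : ℝ} (hw : w ≠ 0)
    (hc : ∀ y ∈ closedBall x σ, ∀ v ∈ clarkeSubdiff f y, c * ‖w‖ ≤ inner ℝ w v)
    (hg : g ∈ goldsteinSubdiff σ f x) : c ≤ ‖g‖ := by
  have hsub : goldsteinSubdiff σ f x ⊆ {v | c * ‖w‖ ≤ inner ℝ w v} := by
    refine convexHull_min ?_ (convex_halfSpace_ge (innerSL ℝ w).toLinearMap.isLinear _)
    simp only [Set.iUnion_subset_iff]
    exact fun y hy v hv => hc y hy v hv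
  have h1 : c * ‖w‖ ≤ inner ℝ w g := hsub hg
  have h2 := real_inner_le_norm w g
  have h3 := norm_pos_iff.2 hw
  nlinarith

/-- Elements of the Goldstein subdifferential are bounded below in the normal region. -/
lemma eventually_le_norm_goldstein_normal (hA : MainAssumption f φ γ Ca) {m : ℝ} (hm : 0 < m)
    (hmμ : ENNReal.ofReal m ≤ constMu f M x₀) :
    ∀ᶠ x in 𝓝 x₀, ∀ σ : ℝ, 0 < σ → σ * (8 * (m + (constL f x₀).toReal)) ≤ m * infDist x M →
      ∀ g ∈ goldsteinSubdiff σ f x, m / 2 ≤ ‖g‖ := by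
  have hM := hA.activeManifold.mem
  have hL0 : 0 ≤ (constL f x₀).toReal := ENNReal.toReal_nonneg
  have hfin := constL_ne_top (x₀ := x₀) hA.locallyLipschitz
  set L := (constL f x₀).toReal with hL
  -- `L + m` strictly exceeds the modulus even if `L = 0`, and it is the factor that appears in the
  -- bound on `σ`.
  obtain ⟨s, hs, hK⟩ := exists_lipschitzOnWith_of_lipAt_lt (F := f) (x₀ := x₀)
    (c := .mk (L + m) (by positivity)) (by
      have h1 : lipAt f x₀ ≤ constL f x₀ := by rw [constL, two_mul]; exact le_self_add
      rw [← ENNReal.ofReal_eq_coe_nnreal]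
      refine h1.trans_lt ?_
      rw [← ENNReal.ofReal_toReal hfin, ← hL]
      exact (ENNReal.ofReal_lt_ofReal_iff (by positivity)).2 (by linarith))
  have hslope := eventually_lt_infEDist (κ := 2 * m) (constMu_pos hA.activeManifold) (by
    rw [ENNReal.ofReal_mul (by norm_num), ENNReal.ofReal_ofNat]
    gcongr)
  set ε := m / 16 with hε
  have hε0 : 0 < ε := by positivity
  have hsharp := eventually_sharp hA (κ := 2 * m) (ε := ε) (by positivity) hε0 (by linarith) hslope
  have hflat := eventually_abs_sub_le hA hε0
  obtain ⟨o, ho, hb⟩ := hA.bRegular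
  have ho' : ∀ᶠ t in 𝓝 (0 : ℝ), t ≠ 0 → -ε < o t / t :=
    eventually_nhdsWithin_iff.1 (ho.eventually (lt_mem_nhds (by linarith)))
  have hpair : ∀ᶠ q : Vec d × Vec d in 𝓝 (x₀, x₀), ‖q.2 - q.1‖ ≠ 0 →
      -ε < o ‖q.2 - q.1‖ / ‖q.2 - q.1‖ := by
    have : Tendsto (fun q : Vec d × Vec d => ‖q.2 - q.1‖) (𝓝 (x₀, x₀)) (𝓝 0) := by
      have : Continuous fun q : Vec d × Vec d => ‖q.2 - q.1‖ := by fun_prop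
      simpa using this.tendsto (x₀, x₀)
    exact this.eventually ho'
  have hall := (hflat.and (hb.and hpair))
  rw [nhds_prod_eq, Filter.eventually_iff, mem_prod_self_iff] at hall
  obtain ⟨S, hS, hSS⟩ := hall
  obtain ⟨r, hr, hball⟩ := Metric.eventually_nhds_iff_ball.1
    ((hsharp.and (φ.eventually_proj_mem hM)).and
      ((show ∀ᶠ x in 𝓝 x₀, x ∈ S from hS).and (eventually_mem_nhds_iff.2 hs)))
  filter_upwards [ball_mem_nhds x₀ (by positivity : 0 < r / 4)] with x hx σ hσ hσD g hg
  rw [mem_ball, dist_eq_norm] at hx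
  have hball' : ∀ z, ‖z - x₀‖ < r → z ∈ ball x₀ r := fun z hz => by
    rwa [mem_ball, dist_eq_norm]
  have hpx := (hball x (hball' x (by linarith))).1.2
  set p := proj M x with hp
  have hpn := norm_sub_le_of_mem_projSet hM hpx
  have hDp := infDist_eq_of_mem_projSet hpx
  set D := infDist x M with hD
  have hσ8 : 8 * σ ≤ D := by
    refine le_of_mul_le_mul_left ?_ hm
    nlinarith
  have hDpos : 0 < D := by linarith
  have hDx : D ≤ ‖x - x₀‖ := by
    rw [hD, ← dist_eq_norm]; exact infDist_le_dist_of_mem hM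
  refine le_norm_of_mem_goldsteinSubdiff (w := x - p)
    (by rw [← norm_pos_iff, ← hDp]; exact hDpos) ?_ hg
  intro y hy v hv
  rw [mem_closedBall, dist_eq_norm] at hy
  rw [← hDp]
  have hyr : y ∈ ball x₀ r := hball' y (by
    linarith [norm_sub_le_norm_sub_add_norm_sub y x x₀])
  have hpr : p ∈ ball x₀ r := hball' p (by linarith)
  obtain ⟨⟨hy1, hy2⟩, hy3, hy4⟩ := hball y hyr
  have hqn := norm_sub_le_of_mem_projSet hM hy2
  have hDq := infDist_eq_of_mem_projSet hy2
  have hqr : proj M y ∈ ball x₀ r := hball' _ (by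
    linarith [norm_sub_le_norm_sub_add_norm_sub y x x₀])
  set q := proj M y with hq
  have e1 := (hSS (Set.mk_mem_prod (hball q hqr).2.1 (hball p hpr).2.1)).1 hy2.1 hpx.1
  have e2 := (hSS (Set.mk_mem_prod hy3 (hball p hpr).2.1)).2.1 hpx.1 v hv
  have e3 := (hSS (Set.mk_mem_prod hy3 (hball p hpr).2.1)).2.2
  dsimp only at e1 e2 e3
  have hv' : ‖v‖ ≤ L + m := norm_le_of_mem_clarkeSubdiff hy4 hK hv
  have hdy : D ≤ infDist y M + σ := by
    have := infDist_le_infDist_add_dist (s := M) (x := x) (y := y)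
    rw [dist_eq_norm, norm_sub_rev] at this
    linarith
  have hyp : ‖p - y‖ ≤ 9 / 8 * D := by
    have := norm_sub_le_norm_sub_add_norm_sub p x y
    rw [norm_sub_rev p x, norm_sub_rev x y] at this
    linarith
  have hyp0 : 0 < ‖p - y‖ := by
    have : infDist y M ≤ ‖y - p‖ := by
      rw [← dist_eq_norm]; exact infDist_le_dist_of_mem hpx.1
    rw [norm_sub_rev] at this
    linarith
  have hqp : ‖q - p‖ ≤ 9 / 4 * D := by
    have h1 := norm_sub_le_norm_sub_add_norm_sub q y p
    have h2 := hy2.2 p hpx.1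
    rw [norm_sub_rev y p] at h1
    linarith
  have e4 := e3 hyp0.ne'
  rw [lt_div_iff₀ hyp0] at e4
  have e5 := (abs_le.1 e1).1
  -- The first term is bounded below by (A4), sharpness at `y` and flatness between `q` and `p`; the
  -- second is at least `-(L + m) σ ≥ -m D / 8`. Since `infDist y M ≥ 7 D / 8` and `ε = m / 16`, the
  -- sum exceeds `m D / 2`.
  have e6 : inner ℝ (x - p) v = -inner ℝ v (p - y) + inner ℝ v (x - y) := by
    rw [real_inner_comm, ← inner_neg_right, ← inner_add_right]
    congr 1
    abel
  have e7 : -((L + m) * σ) ≤ inner ℝ v (x - y) := by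
    have h1 := (abs_le.1 (abs_real_inner_le_norm v (x - y))).1
    rw [norm_sub_rev x y] at h1
    have h2 := mul_le_mul hv' hy (norm_nonneg _) (by positivity)
    linarith
  have e8 : ε * ‖p - y‖ ≤ ε * (9 / 8 * D) := by gcongr
  have e9 : ε * ‖q - p‖ ≤ ε * (9 / 4 * D) := by gcongr
  have e10 : (2 * m - 2 * ε) * (7 / 8 * D) ≤ (2 * m - 2 * ε) * infDist y M :=
    mul_le_mul_of_nonneg_left (by linarith) (by linarith)
  have e11 : 0 < m * D := by positivity
  rw [hε] at e8 e9 e10 e4 e5 hy1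
  rw [e6]
  nlinarith

/-- Elements of the Goldstein subdifferential are bounded below in the tangent region. -/
lemma eventually_le_norm_goldstein_tangent (hA : MainAssumption f φ γ Ca) :
    ∀ᶠ x in 𝓝 x₀, ∀ σ a : ℝ, 0 < a → a ≤ 1 / 2 → a * (8 * Ca) ≤ γ → σ ≤ a * ‖proj M x - x₀‖ →
      infDist x M ≤ 2 * a ^ 2 * ‖proj M x - x₀‖ ^ 2 →
      ∀ g ∈ goldsteinSubdiff σ f x, γ / 4 * ‖proj M x - x₀‖ ≤ ‖g‖ := by
  have hM := hA.activeManifold.mem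
  have hγ := hA.γ_pos
  have hCa := hA.Ca_pos
  have hall := hA.strongA
  rw [nhds_prod_eq, Filter.eventually_iff, mem_prod_self_iff] at hall
  obtain ⟨S, hS, hSS⟩ := hall
  obtain ⟨r, hr, hball⟩ := Metric.eventually_nhds_iff_ball.1
    ((eventually_le_norm_covGrad hA (half_pos hγ)).and
      ((show ∀ᶠ x in 𝓝 x₀, x ∈ S from hS).and (covGrad_mem_tangentSpace hA.activeManifold)))
  -- The cap at `1` gives `n ≤ 1/2`, so `2 a n ≤ 1` and the quadratic bound on the distance improves
  -- to `a n`.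
  filter_upwards [ball_mem_nhds x₀ (by positivity : 0 < min r 1 / 4),
    φ.eventually_proj_mem hM] with x hx hpx σ a ha ha2 haC hσ hD g hg
  rw [mem_ball, dist_eq_norm] at hx
  have hr1 : min r 1 ≤ r := min_le_left _ _
  have hr2 : min r 1 ≤ 1 := min_le_right _ _
  have hball' : ∀ z, ‖z - x₀‖ < r → z ∈ ball x₀ r := fun z hz => by
    rwa [mem_ball, dist_eq_norm]
  set p := proj M x with hp
  have hpn := norm_sub_le_of_mem_projSet hM hpx
  have hDp := infDist_eq_of_mem_projSet hpx
  rw [hDp] at hD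
  set n := ‖p - x₀‖ with hn
  have hn0 : 0 ≤ n := norm_nonneg _
  have hn1 : n ≤ 1 / 2 := by linarith
  rcases hn0.eq_or_lt' with h0 | hnpos
  · rw [h0]; simp
  have hpr : p ∈ ball x₀ r := hball' p (by linarith)
  obtain ⟨h1, h2, h3⟩ := hball p hpr
  have h1 := h1 hpx.1
  have h3 := h3 hpx.1
  have han : a * n ≤ n / 2 := by nlinarith
  refine le_norm_of_mem_goldsteinSubdiff (w := covGrad f M p) ?_ ?_ hg
  · rw [← norm_pos_iff]
    refine lt_of_lt_of_le ?_ h1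
    have : γ - γ / 2 = γ / 2 := by ring
    rw [this]; positivity
  intro y hy v hv
  rw [mem_closedBall, dist_eq_norm] at hy
  have hyr : y ∈ ball x₀ r := hball' y (by
    linarith [norm_sub_le_norm_sub_add_norm_sub y x x₀])
  have h4 := (hSS (Set.mk_mem_prod (hball y hyr).2.1 h2)) hpx.1 v hv
  dsimp only at h4
  set w := covGrad f M p with hw
  -- As `w` is tangent, only the tangential part of `v - w` matters, and (A3) controls exactly that.
  have h5 : inner ℝ w (v - w) = inner ℝ w ((φ.tangentSpace p).starProjection (v - w)) := by
    rw [← Submodule.inner_starProjection_left_eq_right, Submodule.starProjection_eq_self_iff.2 h3]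
  have h6 := (abs_le.1 (abs_real_inner_le_norm w
    ((φ.tangentSpace p).starProjection (v - w)))).1
  rw [← h5, inner_sub_right, real_inner_self_eq_norm_sq] at h6
  have hyp : ‖y - p‖ ≤ 2 * (a * n) := by
    have h7 := norm_sub_le_norm_sub_add_norm_sub y x p
    have h8 : 2 * a ^ 2 * n ^ 2 ≤ a * n := by
      have : a * n * (2 * (a * n)) ≤ a * n * 1 :=
        mul_le_mul_of_nonneg_left (by linarith) (by positivity)
      nlinarith
    linarith
  have h9 : Ca * ‖y - p‖ ≤ γ / 4 * n := by
    have h10 := mul_le_mul_of_nonneg_left hyp hCa.le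
    nlinarith
  have hw0 := norm_nonneg w
  have h10 : ‖w‖ * ‖(φ.tangentSpace p).starProjection (v - w)‖ ≤ ‖w‖ * (γ / 4 * n) :=
    mul_le_mul_of_nonneg_left (h4.trans h9) hw0
  have h11 : ‖w‖ * ((γ - γ / 2) * n) ≤ ‖w‖ * ‖w‖ := mul_le_mul_of_nonneg_left h1 hw0
  nlinarith

end GradientInequality

/-! ### Positivity of the constants and extended-real arithmetic. -/

section Constants

variable {d : ℕ} {f : Vec d → ℝ} {M : Set (Vec d)} {x₀ : Vec d}
variable {φ : LocalDefiningMap 4 M x₀} {γ Ca : ℝ}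

lemma constD1_pos (hA : MainAssumption f φ γ Ca) : 0 < constD1 f M x₀ := by
  unfold constD1
  split_ifs with h
  · norm_num
  · exact ENNReal.div_pos (constMu_pos hA.activeManifold).ne'
      (ENNReal.mul_ne_top (by norm_num)
        (ENNReal.add_ne_top.2 ⟨h, constL_ne_top hA.locallyLipschitz⟩))

lemma constC2_pos {δ : ℝ} (hA : MainAssumption f φ γ Ca) (hδ : 0 < δ) : 0 < constC2 γ Ca δ := by
  have := hA.γ_pos
  have := hA.Ca_pos
  unfold constC2
  positivity

lemma deltaGI_pos {δ : ℝ} (hA : MainAssumption f φ γ Ca) (hδ : 0 < δ) :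
    0 < deltaGI f M x₀ δ :=
  lt_min (ENNReal.ofReal_pos.2 (by positivity))
    (ENNReal.div_pos (constD1_pos hA).ne' (constCM_ne_top φ hA.activeManifold.mem))

lemma constEta_pos (hA : MainAssumption f φ γ Ca) {a₁ a₂ : ℝ} (h₁ : 0 < a₁) (h₂ : 0 < a₂) :
    0 < constEta f M x₀ γ a₁ a₂ := by
  have hL := constL_ne_top (x₀ := x₀) hA.locallyLipschitz
  have hβ := constBeta_ne_top hA.activeManifold
  have hγ := hA.γ_pos
  have hμ := constMu_pos hA.activeManifold
  refine lt_min (ENNReal.div_pos (ENNReal.ofReal_pos.2 (by positivity)).ne' ?_)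
    (ENNReal.div_pos (mul_ne_zero hμ.ne' (ENNReal.ofReal_pos.2 h₁).ne') ?_)
  · exact ENNReal.mul_ne_top (by norm_num) (max_lt (ENNReal.mul_ne_top
      (ENNReal.mul_ne_top (by norm_num) hL) ENNReal.ofReal_ne_top).lt_top hβ.lt_top).ne
  · exact ENNReal.mul_ne_top (by norm_num) (max_lt (ENNReal.mul_ne_top (by norm_num) hL).lt_top
      (ENNReal.div_ne_top hβ (ENNReal.ofReal_pos.2 (by positivity)).ne').lt_top).ne

/-- `T` is the common scale of gap and subgradient bound: `D / 4` in the normal region, `n² / 8` in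
the tangent one. No finiteness or nonvanishing is needed, so `η = ∞` is covered. -/
lemma mul_le_of_le_div_of_le_mul_ennreal {η A D F T R : ℝ≥0∞} (hη : η ≤ A / D) (hF : F ≤ D * T)
    (hR : A * T ≤ R) : η * F ≤ R :=
  calc η * F ≤ A / D * (D * T) := mul_le_mul' hη hF
    _ = A / D * D * T := (mul_assoc _ _ _).symm
    _ ≤ A * T := mul_le_mul_left (by rw [mul_comm]; exact ENNReal.mul_div_le) T
    _ ≤ R := hR

end Constants

/-! ### The gradient inequality. -/

theorem mainTheorem3 {d : ℕ} (f : Vec d → ℝ) (M : Set (Vec d)) (xbar : Vec d)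
    (φ : LocalDefiningMap 4 M xbar) (γ Ca : ℝ) (hA : MainAssumption f φ γ Ca) :
    ∃ δ₀ : ℝ, 0 < δ₀ ∧ ∀ δA : ℝ, 0 < δA → δA ≤ δ₀ →
      0 < constD1 f M xbar ∧ 0 < constC2 γ Ca δA ∧ 0 < deltaGI f M xbar δA ∧
      ∀ a₁ a₂ : ℝ, 0 < a₁ → ENNReal.ofReal a₁ ≤ constD1 f M xbar →
        0 < a₂ → a₂ ≤ constC2 γ Ca δA →
        0 < constEta f M xbar γ a₁ a₂ ∧
        (∀ (x : Vec d) (σ : ℝ), edist x xbar < deltaGI f M xbar δA → 0 < σ →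
          (NormalRegion M xbar a₁ a₂ x σ ∨ TangentRegion M xbar a₂ x σ) →
          constEta f M xbar γ a₁ a₂ * ENNReal.ofReal (f x - f xbar) ≤
            ENNReal.ofReal (σ * Metric.infDist 0 (goldsteinSubdiff σ f x))) ∧
        (∀ x : Vec d, edist x xbar < deltaGI f M xbar δA → x ≠ xbar →
          ∃ σ : ℝ, 0 < σ ∧
            (NormalRegion M xbar a₁ a₂ x σ ∨ TangentRegion M xbar a₂ x σ)) := by
  have hγ := hA.γ_pos
  have hCa := hA.Ca_pos
  have hμpos := constMu_pos hA.activeManifold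
  have hLfin := constL_ne_top (x₀ := xbar) hA.locallyLipschitz
  have hβfin := constBeta_ne_top hA.activeManifold
  have hL0 : 0 ≤ (constL f xbar).toReal := ENNReal.toReal_nonneg
  have hβ0 : 0 ≤ (constBeta f M xbar).toReal := ENNReal.toReal_nonneg
  have hLe := ENNReal.ofReal_toReal hLfin
  have hβe := ENNReal.ofReal_toReal hβfin
  -- If `μ = ∞`, every slope is admissible, in particular one above a local Lipschitz constant; then
  -- the distance to `M` vanishes near the minimizer and no `σ > 0` lies in the normal region.
  have hnormal : ∀ᶠ x in 𝓝 xbar, (constMu f M xbar = ∞ → infDist x M = 0) ∧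
      (constMu f M xbar ≠ ∞ → ∀ σ : ℝ, 0 < σ →
        σ * (8 * ((constMu f M xbar).toReal + (constL f xbar).toReal)) ≤
          (constMu f M xbar).toReal * infDist x M →
        ∀ g ∈ goldsteinSubdiff σ f x, (constMu f M xbar).toReal / 2 ≤ ‖g‖) := by
    by_cases htop : constMu f M xbar = ∞
    · obtain ⟨K, s, hs, hK⟩ := hA.locallyLipschitz xbar
      filter_upwards [eventually_infDist_eq_zero_of_slope hA hs hK (lt_add_one (K : ℝ))
        (by rw [htop]; simp)] with x hx
      exact ⟨fun _ => hx, fun h => absurd htop h⟩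
    · filter_upwards [eventually_le_norm_goldstein_normal hA
        (ENNReal.toReal_pos hμpos.ne' htop) (ENNReal.ofReal_toReal htop).le] with x hx
      exact ⟨fun h => absurd h htop, fun _ => hx⟩
  obtain ⟨r, hr, hball⟩ := Metric.eventually_nhds_iff_ball.1
    ((hnormal.and (eventually_le_norm_goldstein_tangent hA)).and
      ((eventually_sub_le hA).and (φ.eventually_proj_mem hA.activeManifold.mem)))
  refine ⟨r, hr, fun δA hδ hδr => ⟨constD1_pos hA, constC2_pos hA hδ, deltaGI_pos hA hδ,
    fun a₁ a₂ h₁ h₁' h₂ h₂' => ⟨constEta_pos hA h₁ h₂, ?_⟩⟩⟩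
  have ha2 : a₂ ≤ 1 / 2 :=
    h₂'.trans ((min_le_right _ _).trans (by linarith [min_le_left 1 (1 / δA)]))
  have ha2C : a₂ * (8 * Ca) ≤ γ := by
    rw [← le_div_iff₀ (by positivity)]
    exact h₂'.trans (min_le_left _ _)
  have hnear : ∀ x, edist x xbar < deltaGI f M xbar δA → x ∈ ball xbar r := by
    intro x hx
    have h := hx.trans_le (min_le_left _ _)
    rw [edist_dist, ENNReal.ofReal_lt_ofReal_iff (by positivity)] at h
    rw [mem_ball]
    linarith
  refine ⟨fun x σ hx hσ hreg => ?_, fun x hx hxne => ?_⟩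
  · obtain ⟨⟨⟨hn1, hn2⟩, ht⟩, hup, -⟩ := hball x (hnear x hx)
    have hne := goldsteinSubdiff_nonempty hA.locallyLipschitz x hσ
    have hdist : ∀ c : ℝ, (∀ g ∈ goldsteinSubdiff σ f x, c ≤ ‖g‖) →
        c ≤ infDist 0 (goldsteinSubdiff σ f x) := fun c hc =>
      (le_infDist hne).2 fun {g} hg => by rw [dist_zero_left]; exact hc g hg
    set D := infDist x M with hD
    have hD0 : 0 ≤ D := infDist_nonneg
    set n := ‖proj M x - xbar‖
    set L := (constL f xbar).toReal
    set β := (constBeta f M xbar).toReal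
    rcases hreg with ⟨hr1, hr2, hr3⟩ | ⟨hr1, hr2, hr3⟩
    · have hDpos : 0 < D := by
        by_contra! hcon
        have : D = 0 := le_antisymm hcon hD0
        rw [← hD, this] at hr2
        linarith
      have hfin : constMu f M xbar ≠ ∞ := fun h => hDpos.ne' (hn1 h)
      set m := (constMu f M xbar).toReal with hm
      have hmpos : 0 < m := ENNReal.toReal_pos hμpos.ne' hfin
      have hme : ENNReal.ofReal m = constMu f M xbar := ENNReal.ofReal_toReal hfin
      have ha1 : a₁ * (8 * (m + L)) ≤ m := by
        rw [constD1, if_neg hfin, ← hme, ← hLe, ← ENNReal.ofReal_add hmpos.le hL0,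
          ← ENNReal.ofReal_ofNat, ← ENNReal.ofReal_mul (by norm_num),
          ← ENNReal.ofReal_div_of_pos (by positivity),
          ENNReal.ofReal_le_ofReal_iff (by positivity), le_div_iff₀ (by positivity)] at h₁'
        exact h₁'
      have hg := hdist _ (hn2 hfin σ hσ (by
        have : σ * (8 * (m + L)) ≤ a₁ * D * (8 * (m + L)) :=
          mul_le_mul_of_nonneg_right hr2 (by positivity)
        nlinarith))
      -- `σ ≥ a₁ D / 2` times `m / 2` is `m a₁ (D / 4)`. The gap is at most `max (2 L) (β / a₂²) D`,
      -- as `n² ≤ D / a₂²`.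
      refine mul_le_of_le_div_of_le_mul_ennreal (min_le_right _ _)
        (T := ENNReal.ofReal (D / 4)) ?_ ?_
      · have e1 : 2 * constL f xbar = ENNReal.ofReal (2 * L) := by
          rw [ENNReal.ofReal_mul (by norm_num), hLe, ENNReal.ofReal_ofNat]
        rw [e1, ← hβe, ← ENNReal.ofReal_div_of_pos (by positivity), ← ENNReal.ofReal_max,
          ← ENNReal.ofReal_ofNat, ← ENNReal.ofReal_mul (by norm_num),
          ← ENNReal.ofReal_mul (by positivity)]
        refine ENNReal.ofReal_le_ofReal ?_
        have e2 := le_max_left (2 * L) (β / a₂ ^ 2)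
        have e3 := le_max_right (2 * L) (β / a₂ ^ 2)
        have e4 : β * n ^ 2 ≤ β / a₂ ^ 2 * D := by
          rw [div_mul_eq_mul_div, le_div_iff₀ (by positivity)]
          nlinarith
        have e5 := mul_le_mul_of_nonneg_right e2 hD0
        have e6 := mul_le_mul_of_nonneg_right e3 hD0
        linarith
      · rw [← hme, ← ENNReal.ofReal_mul hmpos.le, ← ENNReal.ofReal_mul (by positivity)]
        refine ENNReal.ofReal_le_ofReal ?_
        have := mul_le_mul hr1 hg (by positivity) hσ.le
        linarith
    · rw [div_le_iff₀ hσ] at hr3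
      have hn0 : 0 ≤ n := norm_nonneg _
      have hD2 : D ≤ 2 * a₂ ^ 2 * n ^ 2 := by
        have := mul_le_mul_of_nonneg_left hr2 (by positivity : 0 ≤ 2 * a₂ * n)
        nlinarith
      have hg := hdist _ (ht σ a₂ h₂ ha2 ha2C hr2 hD2)
      -- `σ ≥ a₂ n / 2` times `γ n / 4` is `γ a₂ (n² / 8)`. As `D ≤ 2 a₂² n²`, each of the two gap
      -- terms is at most half of the maximum times `n²`.
      refine mul_le_of_le_div_of_le_mul_ennreal (min_le_left _ _)
        (T := ENNReal.ofReal (n ^ 2 / 8)) ?_ ?_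
      · have e1 : 4 * constL f xbar * ENNReal.ofReal (a₂ ^ 2) =
            ENNReal.ofReal (4 * L * a₂ ^ 2) := by
          rw [ENNReal.ofReal_mul (by positivity), ENNReal.ofReal_mul (by norm_num), hLe,
            ENNReal.ofReal_ofNat]
        rw [e1, ← hβe, ← ENNReal.ofReal_max,
          ← ENNReal.ofReal_ofNat, ← ENNReal.ofReal_mul (by norm_num),
          ← ENNReal.ofReal_mul (by positivity)]
        refine ENNReal.ofReal_le_ofReal ?_
        have hn2' : 0 ≤ n ^ 2 := by positivity
        have e2 := mul_le_mul_of_nonneg_right (le_max_left (4 * L * a₂ ^ 2) β) hn2'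
        have e3 := mul_le_mul_of_nonneg_right (le_max_right (4 * L * a₂ ^ 2) β) hn2'
        have e4 := mul_le_mul_of_nonneg_left hD2 hL0
        linarith
      · rw [← ENNReal.ofReal_mul (by positivity)]
        refine ENNReal.ofReal_le_ofReal ?_
        have := mul_le_mul hr1 hg (by positivity) hσ.le
        linarith
  · obtain ⟨-, -, hpr⟩ := hball x (hnear x hx)
    have hDp := infDist_eq_of_mem_projSet hpr
    have hn0 : 0 ≤ ‖proj M x - xbar‖ := norm_nonneg _
    -- The dichotomy covers every point: take `σ = a₁ D` if this holds and `σ = a₂ n` otherwise. The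
    -- first choice is positive since `D = 0` would force `n = 0` and `x = xbar`.
    by_cases hcase : a₂ ^ 2 * ‖proj M x - xbar‖ ^ 2 ≤ infDist x M
    · have hDpos : 0 < infDist x M := by
        refine lt_of_le_of_ne infDist_nonneg fun h0 => hxne ?_
        rw [← h0] at hcase hDp
        have h3 : x = proj M x := by
          rw [← sub_eq_zero, ← norm_eq_zero]; exact hDp.symm
        have h4 : ‖proj M x - xbar‖ ^ 2 = 0 := by
          have : 0 < a₂ ^ 2 := by positivity
          have h5 := sq_nonneg ‖proj M x - xbar‖
          nlinarith
        rw [h3, ← sub_eq_zero, ← norm_eq_zero]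
        exact pow_eq_zero_iff (two_ne_zero) |>.1 h4
      refine ⟨a₁ * infDist x M, by positivity, .inl ⟨?_, le_rfl, hcase⟩⟩
      have : 0 < a₁ * infDist x M := by positivity
      linarith
    · push Not at hcase
      have hnpos : 0 < ‖proj M x - xbar‖ := by
        refine lt_of_le_of_ne hn0 fun h0 => ?_
        rw [← h0] at hcase
        have := infDist_nonneg (x := x) (s := M)
        norm_num at hcase
        linarith
      have hpos : 0 < a₂ * ‖proj M x - xbar‖ := by positivity
      refine ⟨a₂ * ‖proj M x - xbar‖, hpos, .inr ⟨by linarith, le_rfl, ?_⟩⟩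
      rw [div_le_iff₀ hpos]
      nlinarith
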